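/- Let $H$ be a separable real Hilbert space, $Q$ a bounded selfadjoint nonnegative operator on $H$, and $(S(t))_{t\ge 0}$ a strongly continuous semigroup of bounded operators on $H$, such that $$\int_0^\infty \mathrm{tr}\,\bigl(S(s)QS^*(s)\bigr)\,ds<\infty .$$ Put $Q_t x=\int_0^t S(s)QS^*(s)x\,ds$ for $x\in H$, $0\le t\le\infty$, and assume that $Q_\infty$ is injective. Let $\mu=N(0,Q_\infty)$ be the centered Gaussian measure on $H$ with covariance operator $Q_\infty$, and let $$R_t\varphi(x)=\int_H \varphi\bigl(S(t)x+y\bigr)\,N(0,Q_t)(dy),\qquad t\ge 0,\ x\in H,$$ for bounded Borel $\varphi:H\to\mathbb R$, be the transition semigroup of the Ornstein-Uhlenbeck process $dZ=AZ\,dt+\sqrt Q\,dW$, $Z(0)=x$, where $A$ is the generator of $(S(t))$ and $W$ is a standard cylindrical Wiener process on $H$; its bounded extension to $L^2(H,\mu)$ is still denoted by $R_t$. For $h\in H$ let $\varphi_h=\langle h,Q_\infty^{-1/2}\,\cdot\,\rangle\in L^2(H,\mu)$; that is, $h\mapsto\varphi_h$ is the bounded linear map from $H$ to $L^2(H,\mu)$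 with $\varphi_{Q_\infty^{1/2}k}=\langle k,\cdot\rangle$ for $k\in H$. For a contraction $T$ of $H$ the second quantization $\Gamma(T)$ is the bounded operator on $L^2(H,\mu)$ determined by $$\Gamma(T)\,e^{\varphi_h-\frac12|h|^2}=e^{\varphi_{Th}-\frac12|Th|^2},\qquad h\in H.$$ **Theorem.** Assume that $(R_t)$ is symmetric, i.e. $\int_H\psi R_t\varphi\,d\mu=\int_H\varphi R_t\psi\,d\mu$ for all $t\ge0$ and all bounded Borel $\varphi,\psi$. Let $S_Q(t)=Q^{-1/2}S(t)Q^{1/2}$, a bounded operator on $H$. Then the operator $V=Q^{1/2}Q_\infty^{-1/2}$ with domain $Q_\infty^{1/2}(H)$ is closable, its closure has a polar decomposition $\overline V=U|\overline V|$ with an isometric isomorphism $U$ of $H$ onto $H$, the operator $\mathcal U=\Gamma(U)$ is an isometric isomorphism of $L^2(H,\mu)$ onto itself, and $$R_t=\mathcal U^{-1}\,\Gamma\bigl(S_Q(t)\bigr)\,\mathcal U,\qquad t\ge 0.$$ -/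

import Mathlib

open MeasureTheory ProbabilityTheory Set Filter Topology
open scoped ENNReal NNReal

namespace OrnsteinUhlenbeck

/-- The element described by `p`, and `0` if no element satisfies `p`. It is used below only
for descriptions that at most one element satisfies in the situations of interest. -/
noncomputable def described {X : Type*} [Zero X] (p : X → Prop) : X :=
  open Classical in if h : ∃ x, p x then h.choose else 0

theorem described_spec {X : Type*} [Zero X] {p : X → Prop} (h : ∃ x, p x) :
    p (described p) := by
  classical
  unfold described
  rw [dif_pos h]
  exact h.choose_spec

section Operators

variable {H : Type*} [NormedAddCommGroup H] [InnerProductSpace ℝ H] [CompleteSpace H]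

/-- `S` is a strongly continuous semigroup of bounded operators on `H`; only the values
`S t` with `0 ≤ t` matter. -/
structure IsC0Semigroup (S : ℝ → H →L[ℝ] H) : Prop where
  map_zero : S 0 = ContinuousLinearMap.id ℝ H
  map_add : ∀ s t : ℝ, 0 ≤ s → 0 ≤ t → S (s + t) = (S s).comp (S t)
  continuousOn : ∀ x : H, ContinuousOn (fun t => S t x) (Ici 0)

/-- The trace `∑ ⟪T eᵢ, eᵢ⟫ ∈ [0, ∞]` of a nonnegative selfadjoint operator, in an orthonormal
basis (the value does not depend on the basis). -/
noncomputable def opTrace (T : H →L[ℝ] H) : ℝ≥0∞ :=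
  ∑' i : (exists_hilbertBasis ℝ H).choose,
    ENNReal.ofReal (inner ℝ (T ((exists_hilbertBasis ℝ H).choose_spec.choose i))
      ((exists_hilbertBasis ℝ H).choose_spec.choose i))

/-- The nonnegative selfadjoint square root `T^{1/2}` of a nonnegative selfadjoint operator. -/
noncomputable def sqrtOp (T : H →L[ℝ] H) : H →L[ℝ] H :=
  described fun B => B.IsPositive ∧ B.comp B = T

/-- The operators `Q_t x = ∫₀ᵗ S(s) Q S(s)* x ds` for `t ≤ ∞`. -/
noncomputable def covOp (S : ℝ → H →L[ℝ] H) (Q : H →L[ℝ] H) (t : EReal) : H →L[ℝ] H :=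
  described fun T => ∀ x : H,
    T x = ∫ s in {s : ℝ | 0 < s ∧ (s : EReal) ≤ t}, S s (Q ((S s).adjoint x))

/-- `S_Q(t) = Q^{-1/2} S(t) Q^{1/2}` as a bounded operator on `H`, where `Q^{-1/2}` takes its values
in the orthogonal complement of `ker Q^{1/2}` (which is all of `H` if `Q` is injective). -/
noncomputable def conjSemigroup (S : ℝ → H →L[ℝ] H) (Q : H →L[ℝ] H) (t : ℝ) : H →L[ℝ] H :=
  described fun B => ∀ x : H, B x ∈ (LinearMap.ker (sqrtOp Q).toLinearMap)ᗮ ∧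
    sqrtOp Q (B x) = S t (sqrtOp Q x)

/-- The (in general unbounded) operator `V = Q^{1/2} Q_∞^{-1/2}` with domain
`Q_∞^{1/2}(H)`, for injective `Q_∞ = C`. -/
noncomputable def opV (Q C : H →L[ℝ] H) : H →ₗ.[ℝ] H :=
  (sqrtOp Q).toLinearMap.compPMap ((sqrtOp C).toLinearMap.toPMap ⊤).inverse

/-- `V = U P` is the polar decomposition of the (closed, densely defined) operator `V`: `P` is
nonnegative and selfadjoint, and `U` is the partial isometry that is isometric on the closure of
the range of `P` and zero on its orthogonal complement. Then `P² = V* V`, that is, `P = |V|`. -/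
structure IsPolarDecomposition (V : H →ₗ.[ℝ] H) (U : H →L[ℝ] H) (P : H →ₗ.[ℝ] H) : Prop where
  selfAdjoint : IsSelfAdjoint P
  nonneg : ∀ x : P.domain, 0 ≤ inner ℝ (P x) (x : H)
  eq_comp : V = U.toLinearMap.compPMap P
  isometric : ∀ x ∈ closure (range fun y : P.domain => P y), ‖U x‖ = ‖x‖
  zero : ∀ x : H, (∀ y : P.domain, inner ℝ (P y) x = 0) → U x = 0

end Operators

section Measures

variable {H : Type*} [NormedAddCommGroup H] [InnerProductSpace ℝ H] [CompleteSpace H]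
  [MeasurableSpace H]

/-- `μ` is the Gaussian measure `N(0, C)`: for each `h`, the functional `⟪h, ·⟫` has the normal
law with mean `0` and variance `⟪C h, h⟫`. -/
def IsCenteredGaussian (C : H →L[ℝ] H) (μ : Measure H) : Prop :=
  ∀ h : H, μ.map (fun x => inner ℝ h x) = gaussianReal 0 (inner ℝ (C h) h).toNNReal

/-- The Gaussian measure `N(0, C)`. -/
noncomputable def centeredGaussian (C : H →L[ℝ] H) : Measure H :=
  described (IsCenteredGaussian C)

/-- The invariant measure `μ = N(0, Q_∞)`. -/
noncomputable def invMeasure (S : ℝ → H →L[ℝ] H) (Q : H →L[ℝ] H) : Measure H :=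
  centeredGaussian (covOp S Q ⊤)

/-- The law `N(S(t) x, Q_t)` of the Ornstein-Uhlenbeck process
`Z(t, x) = S(t) x + ∫₀ᵗ S(t - s) Q^{1/2} dW(s)`. -/
noncomputable def ouLaw (S : ℝ → H →L[ℝ] H) (Q : H →L[ℝ] H) (t : ℝ) (x : H) : Measure H :=
  (centeredGaussian (covOp S Q (t : EReal))).map (fun y => S t x + y)

/-- The transition semigroup `R_t φ(x) = E φ(Z(t, x))` on functions. -/
noncomputable def transition (S : ℝ → H →L[ℝ] H) (Q : H →L[ℝ] H) (t : ℝ) (φ : H → ℝ) (x : H) : ℝ :=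
  ∫ y, φ y ∂(ouLaw S Q t x)

/-- Symmetry of `(R_t)` with respect to `μ`:
`∫ ψ R_t φ dμ = ∫ φ R_t ψ dμ` for all bounded Borel functions `φ`, `ψ` and all `t ≥ 0`. -/
def IsSymmetricOU (S : ℝ → H →L[ℝ] H) (Q : H →L[ℝ] H) : Prop :=
  ∀ t : ℝ, 0 ≤ t → ∀ φ ψ : H → ℝ, Measurable φ → Measurable ψ →
    (∃ c : ℝ, ∀ x, |φ x| ≤ c) → (∃ c : ℝ, ∀ x, |ψ x| ≤ c) →
    ∫ x, ψ x * transition S Q t φ x ∂(invMeasure S Q) =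
      ∫ x, φ x * transition S Q t ψ x ∂(invMeasure S Q)

/-- `R_t` as an operator on `L²(H, μ)`: the bounded operator which extends the action of `R_t` on
bounded Borel functions. -/
noncomputable def ouOperator (S : ℝ → H →L[ℝ] H) (Q : H →L[ℝ] H) (t : ℝ) :
    Lp ℝ 2 (invMeasure S Q) →L[ℝ] Lp ℝ 2 (invMeasure S Q) :=
  described fun T => ∀ φ : H → ℝ, Measurable φ → (∃ c : ℝ, ∀ x, |φ x| ≤ c) →
    ∃ hφ : MemLp φ 2 (invMeasure S Q),
      T (hφ.toLp φ) =ᵐ[invMeasure S Q] transition S Q t φ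

/-- The white noise map `h ↦ φ_h = ⟪h, C^{-1/2} ·⟫` of `μ = N(0, C)` with `C` injective: the
bounded linear map `H → L²(H, μ)` with `φ_h = ⟪k, ·⟫` for `h = C^{1/2} k`. -/
noncomputable def whiteNoise (C : H →L[ℝ] H) (μ : Measure H) : H →L[ℝ] Lp ℝ 2 μ :=
  described fun W => ∀ k : H, W (sqrtOp C k) =ᵐ[μ] fun x => inner ℝ k x

/-- The Wick exponential `:exp φ_h: = exp (φ_h - |h|² / 2)`, i.e. the image of the exponential
vector `∑ h^{⊗n} / √(n!)` of the symmetric Fock space over `H` under the Wiener-Itô isomorphism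
with `L²(H, μ)`. -/
noncomputable def wickExp (C : H →L[ℝ] H) (μ : Measure H) (h : H) : H → ℝ :=
  fun x => Real.exp (whiteNoise C μ h x - ‖h‖ ^ 2 / 2)

/-- The second quantization `Γ(T)` on `L²(H, μ)`, `μ = N(0, C)`, of a contraction `T` of `H`: the
bounded operator with `Γ(T) :exp φ_h: = :exp φ_{T h}:` for all `h`. The Wick exponentials
span a dense subspace of `L²(H, μ)`. -/
noncomputable def secondQuantization (C : H →L[ℝ] H) (μ : Measure H) (T : H →L[ℝ] H) :
    Lp ℝ 2 μ →L[ℝ] Lp ℝ 2 μ :=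
  described fun G => ∀ h : H, ∃ hh : MemLp (wickExp C μ h) 2 μ,
    G (hh.toLp (wickExp C μ h)) =ᵐ[μ] wickExp C μ (T h)

end Measures

end OrnsteinUhlenbeck

/-! Write C = Q_∞, A = C^{1/2}, B = Q^{1/2}, and E(h) = exp(φ_h - |h|²/2). The Wick exponentials
E(h) are total in L²(μ) and ⟨E(h), E(k)⟩ = exp ⟨h, k⟩ (`inner_wickLp`), so bounded operators on
L²(μ) can be compared on them.

From C = Q_t + S(t) C S(t)* a Gaussian integral gives R_t E(Ak) = E(A S(t)* k)
(`ouOperator_wickLp`). Thus R_t = Γ(T_t), where T_t is the contraction with T_t A = A S(t)*.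
Symmetry of R_t, tested on exponentials, says S(t) C = C S(t)* (`comp_covOp_of_symmetric`). Then Q_t
= C - C (S(t)*)², and dividing by t as t → 0 turns this into S(t) Q = Q S(t)*
(`comp_eq_comp_adjoint`). So S(t)* is symmetric for both norms ‖A ·‖ and ‖B ·‖, and it induces two
selfadjoint contractions: T_t, and S_Q(t) with S_Q(t) B = B S(t)*.

It remains to find a unitary U with U T_t = S_Q(t) U. Formally V A = B, hence V T_t = S_Q(t) V, and
selfadjointness passes this relation to the polar factor of V. That the closure of V is a
well-defined injective operator follows from t ‖S_Q(t) B x‖² ≤ ‖A x‖² and ‖A x‖² - ‖T_t A x‖² ≤ t ‖B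
x‖², which hold because s ↦ ‖B S(s)* x‖ decreases (`inner_covOp_bounds`), together with T_t → 0
strongly as t → ∞.

No spectral theorem is used for the unbounded V. The closure of its graph {(Ax, Bx)} is {(az, bz)}
with bounded a, b and a*a + b*b = 1 (`exists_common_factor`). With E = (aa*)^{1/2} and D = (1 -
aa*)^{1/2}, the modulus is D E⁻¹ and U sends D E x to b a* x (`exists_polar_bounded`). Everything
reduces to square roots of bounded positive operators and the fact that they commute with whatever
commutes with the operator. Finally Γ(U) Γ(T_t) = Γ(S_Q(t)) Γ(U) is read off on the exponentials. -/

namespace OrnsteinUhlenbeck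

set_option linter.unusedSectionVars false

/-! ### Square roots of bounded positive operators on a real Hilbert space -/

section Sqrt

variable {H : Type*} [NormedAddCommGroup H] [InnerProductSpace ℝ H] [CompleteSpace H]

/-- A positive operator below the identity has norm at most one. -/
theorem norm_le_one_of_isPositive {T : H →L[ℝ] H} (hT : T.IsPositive)
    (h1 : ∀ x, inner ℝ (T x) x ≤ ‖x‖ ^ 2) : ‖T‖ ≤ 1 := by
  refine ContinuousLinearMap.opNorm_le_bound _ zero_le_one fun x => ?_
  rw [one_mul]
  have hs := hT.inner_left_eq_inner_right
  -- Positivity of T at x + r T x, with ⟨T T x, T x⟩ ≤ ‖T x‖². The choice r = -1 yields ‖T x‖² ≤ ⟨T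
  -- x, x⟩.
  have key : ∀ r : ℝ, 0 ≤ inner ℝ (T x) x + 2 * r * ‖T x‖ ^ 2 + r ^ 2 * ‖T x‖ ^ 2 := by
    intro r
    have h := hT.inner_nonneg_left (x + r • T x)
    have h2 := h1 (T x)
    have e : inner ℝ (T (x + r • T x)) (x + r • T x) =
        inner ℝ (T x) x + 2 * r * ‖T x‖ ^ 2 + r ^ 2 * inner ℝ (T (T x)) (T x) := by
      simp only [map_add, map_smul, inner_add_left, inner_add_right, inner_smul_left,
        inner_smul_right, hs (T x) x, real_inner_self_eq_norm_sq, RCLike.conj_to_real]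
      ring
    nlinarith [mul_le_mul_of_nonneg_left h2 (sq_nonneg r)]
  have h := key (-1)
  have h3 := h1 x
  exact abs_le_of_sq_le_sq' (by nlinarith) (norm_nonneg x) |>.2

/-- The iteration `Y ↦ (X + Y²) / 2` whose limit is `1 - √(1 - X)`. -/
noncomputable def sqrtIter {A : Type*} [Ring A] [Algebra ℝ A] (X : A) : ℕ → A
  | 0 => 0
  | n + 1 => (2⁻¹ : ℝ) • (X + sqrtIter X n * sqrtIter X n)

/-- The scalar iteration for X = 1 is the convergent majorant of the operator iteration. -/
theorem sqrtIter_one_bounds (n : ℕ) :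
    0 ≤ sqrtIter (1 : ℝ) n ∧ sqrtIter (1 : ℝ) n ≤ sqrtIter (1 : ℝ) (n + 1) ∧
      sqrtIter (1 : ℝ) (n + 1) ≤ 1 := by
  induction n with
  | zero => norm_num [sqrtIter]
  | succ n ih =>
    have e : sqrtIter (1 : ℝ) (n + 1) = 2⁻¹ * (1 + sqrtIter (1 : ℝ) n * sqrtIter (1 : ℝ) n) := rfl
    have e' : sqrtIter (1 : ℝ) (n + 1 + 1) =
      2⁻¹ * (1 + sqrtIter (1 : ℝ) (n + 1) * sqrtIter (1 : ℝ) (n + 1)) := rfl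
    obtain ⟨h0, h1, h2⟩ := ih
    refine ⟨h0.trans h1, ?_, ?_⟩
    · nlinarith
    · nlinarith

theorem commute_sqrtIter {A : Type*} [Ring A] [Algebra ℝ A] {X Z : A} (h : Commute X Z) (n : ℕ) :
    Commute (sqrtIter X n) Z := by
  induction n with
  | zero => exact Commute.zero_left Z
  | succ n ih => exact (h.add_left (ih.mul_left ih)).smul_left _

/-- All iterates are polynomials in X and commute, so Y_{n+2} - Y_{n+1} = ½ (Y_{n+1} + Y_n)(Y_{n+1}
- Y_n). The scalar iterates obey the same identity, and the bounds propagate by induction. -/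
theorem norm_sqrtIter_le {X : H →L[ℝ] H} (hX : ‖X‖ ≤ 1) (n : ℕ) :
    ‖sqrtIter X n‖ ≤ sqrtIter (1 : ℝ) n ∧
      ‖sqrtIter X (n + 1) - sqrtIter X n‖ ≤ sqrtIter (1 : ℝ) (n + 1) - sqrtIter (1 : ℝ) n := by
  induction n with
  | zero =>
    simp only [sqrtIter, norm_zero, le_refl, mul_zero, add_zero, sub_zero, norm_smul, true_and,
      smul_eq_mul]
    norm_num
    exact hX
  | succ n ih =>
    have e : sqrtIter X (n + 1) = (2⁻¹ : ℝ) • (X + sqrtIter X n * sqrtIter X n) := rfl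
    have e1 : sqrtIter X (n + 1 + 1) = (2⁻¹ : ℝ) • (X + sqrtIter X (n + 1) * sqrtIter X (n + 1)) :=
      rfl
    have f : sqrtIter (1 : ℝ) (n + 1) = 2⁻¹ * (1 + sqrtIter (1 : ℝ) n * sqrtIter (1 : ℝ) n) := rfl
    have f1 : sqrtIter (1 : ℝ) (n + 1 + 1) =
      2⁻¹ * (1 + sqrtIter (1 : ℝ) (n + 1) * sqrtIter (1 : ℝ) (n + 1)) := rfl
    obtain ⟨h1, h2⟩ := ih
    have hn : ‖sqrtIter X (n + 1)‖ ≤ sqrtIter (1 : ℝ) (n + 1) := by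
      rw [e, f, norm_smul]
      norm_num
      refine (norm_add_le _ _).trans (add_le_add hX ((norm_mul_le _ _).trans ?_))
      exact mul_le_mul h1 h1 (norm_nonneg _) (sqrtIter_one_bounds n).1
    refine ⟨hn, ?_⟩
    have c : Commute (sqrtIter X (n + 1)) (sqrtIter X n) :=
      commute_sqrtIter (commute_sqrtIter (Commute.refl X) n).symm (n + 1)
    have d : sqrtIter X (n + 1 + 1) - sqrtIter X (n + 1) = (2⁻¹ : ℝ) •
        ((sqrtIter X (n + 1) + sqrtIter X n) * (sqrtIter X (n + 1) - sqrtIter X n)) := by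
      rw [← c.mul_self_sub_mul_self_eq]
      refine (congrArg₂ (· - ·) e1 e).trans ?_
      rw [← smul_sub, add_sub_add_left_eq_sub]
    have d' : sqrtIter (1 : ℝ) (n + 1 + 1) - sqrtIter (1 : ℝ) (n + 1) = 2⁻¹ *
        ((sqrtIter (1 : ℝ) (n + 1) + sqrtIter (1 : ℝ) n) *
          (sqrtIter (1 : ℝ) (n + 1) - sqrtIter (1 : ℝ) n)) := by
      linear_combination f1 - f
    rw [d, d', norm_smul]
    norm_num
    refine (norm_mul_le _ _).trans (mul_le_mul ((norm_add_le _ _).trans (add_le_add hn h1)) h2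
      (norm_nonneg _) ?_)
    have := sqrtIter_one_bounds n
    linarith

theorem isSelfAdjoint_sqrtIter {X : H →L[ℝ] H} (hX : IsSelfAdjoint X) (n : ℕ) :
    IsSelfAdjoint (sqrtIter X n) := by
  induction n with
  | zero => exact IsSelfAdjoint.zero _
  | succ n ih =>
    refine IsSelfAdjoint.smul (IsSelfAdjoint.all _) (hX.add ?_)
    have := ih.pow 2
    rwa [pow_two] at this

/-- Square roots of positive contractions. -/
theorem exists_sqrt_of_le_one {T : H →L[ℝ] H} (hT : T.IsPositive)
    (h1 : ∀ x, inner ℝ (T x) x ≤ ‖x‖ ^ 2) :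
    ∃ R : H →L[ℝ] H, R.IsPositive ∧ R.comp R = T ∧ ∀ Z, Commute T Z → Commute R Z := by
  set X : H →L[ℝ] H := 1 - T with hXdef
  have hXs : IsSelfAdjoint X := (IsSelfAdjoint.one _).sub hT.isSelfAdjoint
  have hXp : X.IsPositive := by
    rw [ContinuousLinearMap.isPositive_def']
    refine ⟨hXs, fun x => ?_⟩
    rw [ContinuousLinearMap.reApplyInnerSelf_apply]
    simp only [hXdef, _root_.sub_apply, one_apply_eq_self, inner_sub_left,
      real_inner_self_eq_norm_sq, RCLike.re_to_real]
    linarith [h1 x]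
  have hX : ‖X‖ ≤ 1 := by
    refine norm_le_one_of_isPositive hXp fun x => ?_
    simp only [hXdef, _root_.sub_apply, one_apply_eq_self, inner_sub_left,
      real_inner_self_eq_norm_sq]
    linarith [hT.inner_nonneg_left x]
  have hcr : CauchySeq (fun n => sqrtIter (1 : ℝ) n) := by
    have hm : Monotone (fun n => sqrtIter (1 : ℝ) n) :=
      monotone_nat_of_le_succ fun n => (sqrtIter_one_bounds n).2.1
    refine (tendsto_atTop_ciSup hm ⟨1, ?_⟩).cauchySeq
    rintro _ ⟨n, rfl⟩
    exact (sqrtIter_one_bounds n).2.1.trans (sqrtIter_one_bounds n).2.2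
  have hle : ∀ n k, ‖sqrtIter X (n + k) - sqrtIter X n‖ ≤
      sqrtIter (1 : ℝ) (n + k) - sqrtIter (1 : ℝ) n := by
    intro n k
    induction k with
    | zero => simp
    | succ k ih =>
      have := norm_add_le (sqrtIter X (n + k + 1) - sqrtIter X (n + k))
        (sqrtIter X (n + k) - sqrtIter X n)
      rw [sub_add_sub_cancel] at this
      have h2 := (norm_sqrtIter_le hX (n + k)).2
      rw [← add_assoc]
      linarith
  have hc : CauchySeq (fun n => sqrtIter X n) := by
    rw [Metric.cauchySeq_iff'] at hcr ⊢
    intro ε hε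
    obtain ⟨N, hN⟩ := hcr ε hε
    refine ⟨N, fun n hn => ?_⟩
    obtain ⟨k, rfl⟩ := Nat.exists_eq_add_of_le hn
    rw [dist_eq_norm]
    refine (hle N k).trans_lt ((le_abs_self _).trans_lt ?_)
    exact hN _ hn
  obtain ⟨Y, hY⟩ := cauchySeq_tendsto_of_complete hc
  have hY1 : Tendsto (fun n => sqrtIter X (n + 1)) atTop (𝓝 Y) := hY.comp (tendsto_add_atTop_nat 1)
  have hYeq : Y = (2⁻¹ : ℝ) • (X + Y * Y) :=
    tendsto_nhds_unique hY1 ((tendsto_const_nhds.add (hY.mul hY)).const_smul _)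
  have hYs : IsSelfAdjoint Y :=
    isClosed_eq (continuous_star) continuous_id |>.mem_of_tendsto hY
      (Eventually.of_forall fun n => isSelfAdjoint_sqrtIter hXs n)
  have hYn : ‖Y‖ ≤ 1 := le_of_tendsto hY.norm (Eventually.of_forall fun n =>
    (norm_sqrtIter_le hX n).1.trans ((sqrtIter_one_bounds n).2.1.trans (sqrtIter_one_bounds n).2.2))
  refine ⟨1 - Y, ?_, ?_, ?_⟩
  · rw [ContinuousLinearMap.isPositive_def']
    refine ⟨(IsSelfAdjoint.one _).sub hYs, fun x => ?_⟩
    rw [ContinuousLinearMap.reApplyInnerSelf_apply]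
    simp only [_root_.sub_apply, one_apply_eq_self, inner_sub_left,
      real_inner_self_eq_norm_sq, RCLike.re_to_real]
    have h2 := real_inner_le_norm (Y x) x
    have h3 := Y.le_opNorm x
    nlinarith [norm_nonneg x, norm_nonneg (Y x), mul_nonneg (sub_nonneg.2 hYn) (norm_nonneg x)]
  -- The fixed point equation 2Y = X + Y² is (1 - Y)² = 1 - X, and 1 - X = T.
  · change (1 - Y) * (1 - Y) = T
    have h2 : (2 : ℝ) • Y = X + Y * Y := by
      conv_lhs => rw [hYeq]
      rw [smul_smul]; norm_num
    rw [two_smul, hXdef] at h2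
    have : (1 - Y) * (1 - Y) = 1 - (Y + Y) + Y * Y := by noncomm_ring
    rw [this, h2]
    abel
  · intro Z hZ
    have hXZ : Commute X Z := (Commute.one_left Z).sub_left hZ
    refine (Commute.one_left Z).sub_left ?_
    refine tendsto_nhds_unique (hY.mul_const Z) ?_
    simp_rw [fun n => (commute_sqrtIter hXZ n).eq]
    exact hY.const_mul Z

/-- A positive operator on a real Hilbert space has a positive square root that commutes with
every operator commuting with it. -/
theorem exists_sqrt {T : H →L[ℝ] H} (hT : T.IsPositive) :
    ∃ R : H →L[ℝ] H, R.IsPositive ∧ R.comp R = T ∧ ∀ Z, Commute T Z → Commute R Z := by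
  -- Rescaling makes T a contraction; the added 1 keeps c positive when T = 0.
  set c : ℝ := ‖T‖ + 1
  have hc : 0 < c := by positivity
  obtain ⟨R, hR, hR2, hRc⟩ := exists_sqrt_of_le_one (T := c⁻¹ • T)
    (hT.smul_of_nonneg (inv_nonneg.2 hc.le)) (fun x => by
      rw [_root_.smul_apply, inner_smul_left, RCLike.conj_to_real,
        inv_mul_le_iff₀ hc]
      have h2 := real_inner_le_norm (T x) x
      have h3 := T.le_opNorm x
      nlinarith [norm_nonneg x, sq_nonneg ‖x‖])
  refine ⟨√c • R, hR.smul_of_nonneg (Real.sqrt_nonneg c), ?_, fun Z hZ =>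
    (hRc Z (hZ.smul_left _)).smul_left _⟩
  rw [ContinuousLinearMap.smul_comp, ContinuousLinearMap.comp_smul, hR2, smul_smul, smul_smul,
    Real.mul_self_sqrt hc.le, mul_inv_cancel₀ hc.ne', one_smul]

/-- Later arguments use only these two properties, so uniqueness of the positive root is never
needed. -/
theorem sqrtOp_spec {T : H →L[ℝ] H} (hT : T.IsPositive) :
    (sqrtOp T).IsPositive ∧ (sqrtOp T).comp (sqrtOp T) = T :=
  described_spec (p := fun B : H →L[ℝ] H => B.IsPositive ∧ B.comp B = T)
    (let ⟨R, h1, h2, _⟩ := exists_sqrt hT; ⟨R, h1, h2⟩)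

end Sqrt

/-! ### Polar decomposition of a quotient B A⁻¹ in terms of bounded operators -/

section Polar

/-- Two linear maps with dense range and the same norms differ by an isometric isomorphism. -/
theorem exists_linearIsometryEquiv {E F G : Type*} [AddCommGroup E] [Module ℝ E]
    [NormedAddCommGroup F] [NormedSpace ℝ F] [CompleteSpace F]
    [NormedAddCommGroup G] [NormedSpace ℝ G] [CompleteSpace G]
    (e : E →ₗ[ℝ] F) (f : E →ₗ[ℝ] G) (he : DenseRange e) (hf : DenseRange f)
    (h : ∀ x, ‖f x‖ = ‖e x‖) : ∃ Φ : F ≃ₗᵢ[ℝ] G, ∀ x, Φ (e x) = f x := by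
  have h1 : ∃ C, ∀ x, ‖f (LinearEquiv.refl ℝ E x)‖ ≤ C * ‖e x‖ := ⟨1, fun x => by simp [h]⟩
  have h2 : ∃ C, ∀ x, ‖e ((LinearEquiv.refl ℝ E).symm x)‖ ≤ C * ‖f x‖ := ⟨1, fun x => by simp [h]⟩
  set Ψ := (LinearEquiv.refl ℝ E).extend e f he h1 hf h2
  have hΨ : ∀ x, Ψ (e x) = f x := fun x => LinearEquiv.extend_eq _ e f he h1 hf h2 x
  refine ⟨⟨Ψ.toLinearEquiv, fun x => ?_⟩, hΨ⟩
  refine he.induction (P := fun x => ‖Ψ x‖ = ‖x‖) ?_ ?_ x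
  · rintro _ ⟨y, rfl⟩
    rw [hΨ, h]
  · exact isClosed_eq (by fun_prop) (by fun_prop)

variable {H : Type*} [NormedAddCommGroup H] [InnerProductSpace ℝ H] [CompleteSpace H]

theorem denseRange_of_adjoint_injective {T : H →L[ℝ] H}
    (h : ∀ x, ContinuousLinearMap.adjoint T x = 0 → x = 0) : DenseRange T := by
  have h1 : Dense (LinearMap.range T.toLinearMap : Set H) := by
    rw [Submodule.dense_iff_topologicalClosure_eq_top, Submodule.topologicalClosure_eq_top_iff,
      Submodule.eq_bot_iff]
    intro x hx
    refine h x (ext_inner_right ℝ fun y => ?_)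
    rw [ContinuousLinearMap.adjoint_inner_left, inner_zero_left, real_inner_comm]
    exact (Submodule.mem_orthogonal _ _).1 hx _ ⟨y, rfl⟩
  rwa [LinearMap.coe_range] at h1

theorem eq_zero_of_denseRange {T : H →L[ℝ] H} (h : DenseRange T) {x : H}
    (hx : ∀ y, inner ℝ (T y) x = 0) : x = 0 := by
  have : ∀ z, inner ℝ z x = 0 := by
    refine fun z => h.induction (P := fun z => inner ℝ z x = 0) ?_ ?_ z
    · rintro _ ⟨y, rfl⟩
      exact hx y
    · exact isClosed_eq (by fun_prop) (by fun_prop)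
  exact inner_self_eq_zero.1 (this x)

theorem adjoint_injective_of_denseRange {T : H →L[ℝ] H} (h : DenseRange T) {x : H}
    (hx : ContinuousLinearMap.adjoint T x = 0) : x = 0 :=
  eq_zero_of_denseRange h fun y => by
    rw [← ContinuousLinearMap.adjoint_inner_right, hx, inner_zero_right]

theorem norm_sq_eq_inner_of_comp_self {R T : H →L[ℝ] H} (hR : R.IsPositive) (h : R.comp R = T)
    (x : H) : ‖R x‖ ^ 2 = inner ℝ (T x) x := by
  rw [← h, ContinuousLinearMap.comp_apply, hR.inner_left_eq_inner_right,
    real_inner_self_eq_norm_sq]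

theorem denseRange_of_isPositive {T : H →L[ℝ] H} (hT : T.IsPositive)
    (h : ∀ x, T x = 0 → x = 0) : DenseRange T :=
  denseRange_of_adjoint_injective fun x hx => h x (by rwa [hT.isSelfAdjoint.adjoint_eq] at hx)

/-- The operators `A`, `B` factor through `(A* A + B* B)^{1/2}`. -/
theorem exists_common_factor (A B : H →L[ℝ] H) (hA : ∀ x, A x = 0 → x = 0) :
    ∃ a b n : H →L[ℝ] H, DenseRange n ∧ (∀ x, a (n x) = A x) ∧ (∀ x, b (n x) = B x) ∧
      ∀ z, ‖a z‖ ^ 2 + ‖b z‖ ^ 2 = ‖z‖ ^ 2 := by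
  -- ‖n x‖² = ‖A x‖² + ‖B x‖² is the graph norm of B A⁻¹ at A x. Both A and B are therefore
  -- dominated by n and extend from the dense range of n.
  obtain ⟨n, hn, hn2, -⟩ := exists_sqrt
    ((ContinuousLinearMap.isPositive_adjoint_comp_self A).add
      (ContinuousLinearMap.isPositive_adjoint_comp_self B))
  have hnorm : ∀ x, ‖A x‖ ^ 2 + ‖B x‖ ^ 2 = ‖n x‖ ^ 2 := by
    intro x
    rw [norm_sq_eq_inner_of_comp_self hn hn2, _root_.add_apply, inner_add_left,
      ContinuousLinearMap.comp_apply, ContinuousLinearMap.comp_apply,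
      ContinuousLinearMap.adjoint_inner_left, ContinuousLinearMap.adjoint_inner_left,
      real_inner_self_eq_norm_sq, real_inner_self_eq_norm_sq]
  have hd : DenseRange n.toLinearMap := denseRange_of_isPositive hn fun x hx => by
    have := hnorm x
    rw [hx, norm_zero] at this
    refine hA x (norm_eq_zero.1 (pow_eq_zero_iff (two_ne_zero) |>.1 ?_))
    nlinarith [sq_nonneg ‖A x‖, sq_nonneg ‖B x‖]
  have hAn : ∃ C, ∀ x, ‖A.toLinearMap x‖ ≤ C * ‖n.toLinearMap x‖ := ⟨1, fun x => by
    rw [one_mul]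
    exact abs_le_of_sq_le_sq' (by have := hnorm x; simp; nlinarith [sq_nonneg ‖B x‖])
      (norm_nonneg _) |>.2⟩
  have hBn : ∃ C, ∀ x, ‖B.toLinearMap x‖ ≤ C * ‖n.toLinearMap x‖ := ⟨1, fun x => by
    rw [one_mul]
    exact abs_le_of_sq_le_sq' (by have := hnorm x; simp; nlinarith [sq_nonneg ‖A x‖])
      (norm_nonneg _) |>.2⟩
  have ha := LinearMap.extendOfNorm_eq hd hAn
  have hb := LinearMap.extendOfNorm_eq hd hBn
  refine ⟨A.toLinearMap.extendOfNorm n.toLinearMap, B.toLinearMap.extendOfNorm n.toLinearMap, n,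
    hd, ha, hb, fun z => ?_⟩
  refine hd.induction (P := fun z => ‖A.toLinearMap.extendOfNorm n.toLinearMap z‖ ^ 2 +
    ‖B.toLinearMap.extendOfNorm n.toLinearMap z‖ ^ 2 = ‖z‖ ^ 2) ?_ ?_ z
  · rintro _ ⟨y, rfl⟩
    rw [ha, hb]
    exact hnorm y
  · exact isClosed_eq (by fun_prop) (by fun_prop)

/-- The operator `B A⁻¹` with domain the range of `A`. -/
noncomputable def quotOp (A B : H →L[ℝ] H) : H →ₗ.[ℝ] H :=
  B.toLinearMap.compPMap ((A.toLinearMap.toPMap ⊤).inverse)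

/-- Parametrising the graph by z ↦ (A z, B z) turns every question about the unbounded quotient into
one about bounded operators. -/
theorem mem_graph_quotOp {A B : H →L[ℝ] H} (hA : ∀ x, A x = 0 → x = 0) {p : H × H} :
    p ∈ (quotOp A B).graph ↔ ∃ z, p = (A z, B z) := by
  have hk : LinearMap.ker (A.toLinearMap.toPMap ⊤).toFun = ⊥ := by
    rw [LinearMap.ker_eq_bot']
    rintro ⟨x, hx⟩ h
    ext
    exact hA x h
  have hinv : ∀ (z : H) (y : (A.toLinearMap.toPMap ⊤).inverse.domain), (y : H) = A z →
      (A.toLinearMap.toPMap ⊤).inverse y = z := fun z y hy =>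
    LinearPMap.inverse_apply_eq hk (x := ⟨z, trivial⟩) hy.symm
  rw [LinearPMap.mem_graph_iff]
  constructor
  · rintro ⟨y, h1, h2⟩
    have hy : (y : H) ∈ (A.toLinearMap.toPMap ⊤).inverse.domain := y.2
    rw [LinearPMap.inverse_domain] at hy
    obtain ⟨⟨z, hz⟩, hzy⟩ := hy
    have hzy' : (y : H) = A z := hzy.symm
    refine ⟨z, Prod.ext (h1.symm.trans hzy') ?_⟩
    rw [← h2]
    exact congrArg B (hinv z y hzy')
  · rintro ⟨z, rfl⟩
    have hd : A z ∈ (A.toLinearMap.toPMap ⊤).inverse.domain := by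
      rw [LinearPMap.inverse_domain]
      exact ⟨⟨z, trivial⟩, rfl⟩
    exact ⟨⟨A z, hd⟩, rfl, congrArg B (hinv z ⟨A z, hd⟩ rfl)⟩

theorem mem_graph_compPMap {U : H →L[ℝ] H} {P : H →ₗ.[ℝ] H} {p : H × H} :
    p ∈ (U.toLinearMap.compPMap P).graph ↔ ∃ y, (p.1, y) ∈ P.graph ∧ U y = p.2 := by
  simp only [LinearPMap.mem_graph_iff]
  constructor
  · rintro ⟨y, h1, h2⟩
    exact ⟨P y, ⟨y, h1, rfl⟩, h2⟩
  · rintro ⟨_, ⟨y, h1, rfl⟩, h2⟩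
    exact ⟨y, h1, h2⟩

theorem dense_domain_quotOp {A B : H →L[ℝ] H} (hA : ∀ x, A x = 0 → x = 0) (hd : DenseRange A) :
    Dense ((quotOp A B).domain : Set H) := by
  refine hd.mono ?_
  rintro _ ⟨z, rfl⟩
  exact LinearPMap.mem_domain_of_mem_graph ((mem_graph_quotOp (B := B) hA).2 ⟨z, rfl⟩)

/-- `D E⁻¹` is selfadjoint if `D`, `E` are commuting selfadjoint operators with `D² + E² = 1`. -/
theorem isSelfAdjoint_quotOp {E D : H →L[ℝ] H} (hE : E.IsPositive) (hD : D.IsPositive)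
    (hE0 : ∀ x, E x = 0 → x = 0) (hED : ∀ x, E (D x) = D (E x))
    (h1 : ∀ x, E (E x) + D (D x) = x) : IsSelfAdjoint (quotOp E D) := by
  have hEd := denseRange_of_isPositive hE hE0
  have hdom := dense_domain_quotOp (B := D) hE0 hEd
  rw [LinearPMap.isSelfAdjoint_def]
  refine LinearPMap.eq_of_eq_graph ?_
  rw [LinearPMap.adjoint_graph_eq_graph_adjoint hdom]
  ext ⟨y, w⟩
  rw [Submodule.mem_adjoint_iff, mem_graph_quotOp hE0]
  constructor
  · intro h
    have hyw : D y = E w := by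
      refine ext_inner_left ℝ fun z => ?_
      have := h (E z) (D z) ((mem_graph_quotOp hE0).2 ⟨z, rfl⟩)
      rw [hD.inner_left_eq_inner_right, hE.inner_left_eq_inner_right] at this
      exact sub_eq_zero.1 this
    -- Membership in the adjoint graph amounts to D y = E w. If (y, w) = (E z, D z), then E² + D² =
    -- 1 forces z = D w + E y.
    refine ⟨D w + E y, Prod.ext ?_ ?_⟩
    · simp only [map_add]
      rw [hED, ← hyw, add_comm, h1]
    · simp only [map_add]
      rw [← hED, hyw, add_comm, h1]
  · rintro ⟨z, hz⟩ a b hab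
    obtain ⟨x, hx⟩ := (mem_graph_quotOp hE0).1 hab
    simp only [Prod.mk.injEq] at hz hx
    rw [hz.1, hz.2, hx.1, hx.2, hD.inner_left_eq_inner_right, hE.inner_left_eq_inner_right, hED,
      sub_self]

/-- The polar decomposition of the closed operator with graph `{(a z, b z)}`, in bounded form:
`a w = E` and `b w = U D` with unitary operators `U`, `w`. -/
theorem exists_polar_bounded {a b : H →L[ℝ] H} (hab : ∀ z, ‖a z‖ ^ 2 + ‖b z‖ ^ 2 = ‖z‖ ^ 2)
    (ha : ∀ z, a z = 0 → z = 0) (hb : ∀ z, b z = 0 → z = 0)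
    (had : DenseRange a) (hbd : DenseRange b) :
    ∃ (U w : H ≃ₗᵢ[ℝ] H) (E D : H →L[ℝ] H), E.IsPositive ∧ D.IsPositive ∧
      (∀ x, E x = 0 → x = 0) ∧ (∀ x, D x = 0 → x = 0) ∧ (∀ x, E (D x) = D (E x)) ∧
      (∀ x, E (E x) + D (D x) = x) ∧ (∀ x, 0 ≤ inner ℝ (D x) (E x)) ∧
      (∀ x, a (w x) = E x) ∧ (∀ x, b (w x) = U (D x)) ∧
      ∀ T T' L : H →L[ℝ] H, IsSelfAdjoint T → IsSelfAdjoint T' → IsSelfAdjoint L →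
        (∀ x, a (L x) = T (a x)) → (∀ x, b (L x) = T' (b x)) → ∀ x, U (T x) = T' (U x) := by
  set a' := ContinuousLinearMap.adjoint a
  set b' := ContinuousLinearMap.adjoint b
  set R : H →L[ℝ] H := a.comp a'
  have hRp : R.IsPositive := ContinuousLinearMap.isPositive_self_comp_adjoint a
  have hRin : ∀ x, inner ℝ (R x) x = ‖a' x‖ ^ 2 := fun x => by
    rw [← real_inner_self_eq_norm_sq, ContinuousLinearMap.adjoint_inner_right]; rfl
  have ha'0 : ∀ x, a' x = 0 → x = 0 := fun x hx => adjoint_injective_of_denseRange had hx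
  have hb'0 : ∀ x, b' x = 0 → x = 0 := fun x hx => adjoint_injective_of_denseRange hbd hx
  have hR0 : ∀ x, R x = 0 → x = 0 := fun x hx => ha'0 x (ha _ hx)
  have hna : ‖a‖ ≤ 1 := ContinuousLinearMap.opNorm_le_bound _ zero_le_one fun z => by
    rw [one_mul]
    exact abs_le_of_sq_le_sq' (by have := hab z; nlinarith [sq_nonneg ‖b z‖]) (norm_nonneg _) |>.2
  have hna' : ∀ x, ‖a' x‖ ≤ ‖x‖ := fun x => by
    refine (a'.le_opNorm x).trans (mul_le_of_le_one_left (norm_nonneg x) ?_)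
    rwa [ContinuousLinearMap.adjoint.norm_map]
  have h1Rp : (1 - R).IsPositive := by
    rw [ContinuousLinearMap.isPositive_def']
    refine ⟨(IsSelfAdjoint.one _).sub hRp.isSelfAdjoint, fun x => ?_⟩
    rw [ContinuousLinearMap.reApplyInnerSelf_apply]
    simp only [_root_.sub_apply, one_apply_eq_self, inner_sub_left,
      real_inner_self_eq_norm_sq, RCLike.re_to_real, hRin]
    exact sub_nonneg.2 (pow_le_pow_left₀ (norm_nonneg _) (hna' x) 2)
  obtain ⟨E, hE, hE2, hEc⟩ := exists_sqrt hRp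
  obtain ⟨D, hD, hD2, hDc⟩ := exists_sqrt h1Rp
  have hRD : ∀ Z, Commute R Z → Commute D Z := fun Z hZ => hDc Z ((Commute.one_left Z).sub_left hZ)
  have hcED : Commute D E := hRD E (hEc R (Commute.refl R)).symm
  -- F = E^{1/2} commutes with D, so ⟨D x, E x⟩ = ⟨D F x, F x⟩ ≥ 0; this is the nonnegativity of D
  -- E⁻¹.
  obtain ⟨F, hF, hF2, hFc⟩ := exists_sqrt hE
  have hcFD : Commute F D := hFc D hcED.symm
  have hED : ∀ x, E (D x) = D (E x) := fun x => (DFunLike.congr_fun hcED.eq x).symm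
  have hEE : ∀ x, E (E x) = R x := fun x => DFunLike.congr_fun hE2 x
  have hDD : ∀ x, D (D x) = x - R x := fun x => DFunLike.congr_fun hD2 x
  have hE0 : ∀ x, E x = 0 → x = 0 := fun x hx => hR0 x (by rw [← hEE, hx, map_zero])
  -- D x = 0 means a a* x = x. With z = a* x this gives ‖a z‖ = ‖x‖ ≥ ‖z‖, which leaves no room for
  -- b z, and b is injective.
  have hD0 : ∀ x, D x = 0 → x = 0 := by
    intro x hx
    have hx1 : R x = x := by
      have := hDD x
      rw [hx, map_zero] at this
      exact (sub_eq_zero.1 this.symm).symm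
    have h2 := hab (a' x)
    rw [show a (a' x) = x from hx1] at h2
    have h3 : ‖b (a' x)‖ ^ 2 ≤ 0 := by
      have := pow_le_pow_left₀ (norm_nonneg _) (hna' x) 2
      linarith
    refine ha'0 x (hb _ (norm_eq_zero.1 ?_))
    exact pow_eq_zero_iff two_ne_zero |>.1 (le_antisymm h3 (sq_nonneg _))
  have hEd := denseRange_of_isPositive hE hE0
  have hDd := denseRange_of_isPositive hD hD0
  have hEn : ∀ x, ‖a' x‖ = ‖E x‖ := fun x => by
    have := norm_sq_eq_inner_of_comp_self hE hE2 x
    rw [hRin] at this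
    exact ((sq_eq_sq₀ (norm_nonneg _) (norm_nonneg _)).1 this).symm
  have ha'd : DenseRange a' := denseRange_of_adjoint_injective fun x hx => ha x (by
    rwa [ContinuousLinearMap.adjoint_adjoint] at hx)
  obtain ⟨w, hw⟩ := exists_linearIsometryEquiv E.toLinearMap a'.toLinearMap hEd ha'd hEn
  set K : H →L[ℝ] H := b.comp a'
  have hKd : DenseRange K := denseRange_of_adjoint_injective fun x hx => by
    rw [ContinuousLinearMap.adjoint_comp, ContinuousLinearMap.adjoint_adjoint] at hx
    exact hb'0 x (ha _ hx)
  have hDEd : DenseRange (D.comp E) := hDd.comp hEd D.continuous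
  -- ‖b a* x‖² = ‖a* x‖² - ‖a a* x‖² = ‖E x‖² - ‖E² x‖² = ‖D E x‖², so D E x ↦ b a* x is isometric
  -- between dense ranges.
  have hKn : ∀ x, ‖K x‖ = ‖(D.comp E) x‖ := fun x => by
    have h2 := norm_sq_eq_inner_of_comp_self hD hD2 (E x)
    have h3 := hab (a' x)
    have h4 := norm_sq_eq_inner_of_comp_self hE hE2 (E x)
    rw [_root_.sub_apply, one_apply_eq_self, inner_sub_left, real_inner_self_eq_norm_sq,
      ← h4, ← hEn, hEE] at h2
    refine (sq_eq_sq₀ (norm_nonneg _) (norm_nonneg _)).1 ?_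
    change ‖b (a' x)‖ ^ 2 = ‖D (E x)‖ ^ 2
    change ‖R x‖ ^ 2 + _ = _ at h3
    linarith
  obtain ⟨U, hU⟩ := exists_linearIsometryEquiv (D.comp E).toLinearMap K.toLinearMap hDEd hKd hKn
  have hUK : ∀ x, U (D (E x)) = b (a' x) := hU
  have hwa : ∀ x, w (E x) = a' x := hw
  refine ⟨U, w, E, D, hE, hD, hE0, hD0, hED, fun x => by rw [hEE, hDD]; abel, fun x => ?_,
    fun x => ?_, fun x => ?_, ?_⟩
  · rw [← hF2, ContinuousLinearMap.comp_apply, ← hF.inner_left_eq_inner_right,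
      show F (D x) = D (F x) from DFunLike.congr_fun hcFD.eq x]
    exact hD.inner_nonneg_left _
  · refine hEd.induction (P := fun x => a (w x) = E x) ?_ ?_ x
    · rintro _ ⟨y, rfl⟩
      rw [hwa, hEE]
      rfl
    · exact isClosed_eq (by fun_prop) (by fun_prop)
  · refine hEd.induction (P := fun x => b (w x) = U (D x)) ?_ ?_ x
    · rintro _ ⟨y, rfl⟩
      rw [hwa, hUK]
    · exact isClosed_eq (by fun_prop) (by fun_prop)
  · intro T T' L hT hT' hL haL hbL x
    -- The adjoint of a L = T a. It makes T commute with a a*, hence with E and D, so that U T D E =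
    -- b a* T = b L a* = T' b a* = T' U D E.
    have hLa' : ∀ x, L (a' x) = a' (T x) := fun x => by
      refine ext_inner_right ℝ fun z => ?_
      rw [ContinuousLinearMap.adjoint_inner_left, ← hL.adjoint_eq,
        ContinuousLinearMap.adjoint_inner_left, ContinuousLinearMap.adjoint_inner_left, haL,
        ← hT.adjoint_eq, ContinuousLinearMap.adjoint_inner_left, hT.adjoint_eq]
    have hRT : Commute R T := by
      refine ContinuousLinearMap.ext fun x => ?_
      change a (a' (T x)) = T (a (a' x))
      rw [← hLa', haL]
    have hcE := hEc T hRT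
    have hcD := hRD T hRT
    refine hDEd.induction (P := fun x => U (T x) = T' (U x)) ?_ ?_ x
    · rintro _ ⟨y, rfl⟩
      change U (T (D (E y))) = T' (U (D (E y)))
      rw [← show D (T (E y)) = T (D (E y)) from DFunLike.congr_fun hcD.eq (E y),
        ← show E (T y) = T (E y) from DFunLike.congr_fun hcE.eq y, hUK, hUK, ← hLa', hbL]
    · exact isClosed_eq (by fun_prop) (by fun_prop)

/-- Polar decomposition of the closure of `B A⁻¹`, where the closure of its graph
is `{(a z, b z)}`. -/
theorem exists_polarDecomposition {A B a b n : H →L[ℝ] H} (hn : DenseRange n)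
    (haA : ∀ x, a (n x) = A x) (hbB : ∀ x, b (n x) = B x)
    (hab : ∀ z, ‖a z‖ ^ 2 + ‖b z‖ ^ 2 = ‖z‖ ^ 2)
    (hA : ∀ x, A x = 0 → x = 0) (hAd : DenseRange A) (hBd : DenseRange B)
    (ha : ∀ z, a z = 0 → z = 0) (hb : ∀ z, b z = 0 → z = 0) :
    (quotOp A B).IsClosable ∧ ∃ (U : H ≃ₗᵢ[ℝ] H) (P : H →ₗ.[ℝ] H),
      IsPolarDecomposition (quotOp A B).closure (U.toContinuousLinearEquiv : H →L[ℝ] H) P ∧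
      ∀ T T' L : H →L[ℝ] H, IsSelfAdjoint T → IsSelfAdjoint T' →
        (∀ x, A (L x) = T (A x)) → (∀ x, B (L x) = T' (B x)) → ∀ x, U (T x) = T' (U x) := by
  have had : DenseRange a := hAd.mono (by rintro _ ⟨x, rfl⟩; exact ⟨n x, haA x⟩)
  have hbd : DenseRange b := hBd.mono (by rintro _ ⟨x, rfl⟩; exact ⟨n x, hbB x⟩)
  have hcl : ((quotOp A B).graph.topologicalClosure : Submodule ℝ (H × H)) =
      (quotOp a b).graph := by
    refine le_antisymm (Submodule.topologicalClosure_minimal _ ?_ ?_) ?_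
    · intro p hp
      obtain ⟨z, rfl⟩ := (mem_graph_quotOp hA).1 hp
      exact (mem_graph_quotOp ha).2 ⟨n z, by rw [haA, hbB]⟩
    · have hr : ((quotOp a b).graph : Set (H × H)) = range (a.prod b) := by
        ext p
        rw [SetLike.mem_coe, mem_graph_quotOp ha]
        exact ⟨fun ⟨z, hz⟩ => ⟨z, hz.symm⟩, fun ⟨z, hz⟩ => ⟨z, hz.symm⟩⟩
      rw [hr]
      -- In the sup norm of the product, ‖z‖² = ‖a z‖² + ‖b z‖² ≤ 2 ‖(a z, b z)‖²; the constant 2 is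
      -- a convenient bound for √2.
      refine AntilipschitzWith.isClosed_range (K := 2) ?_ (a.prod b).uniformContinuous
      refine AddMonoidHomClass.antilipschitz_of_bound _ fun z => ?_
      have h1 : ‖a z‖ ≤ ‖(a.prod b) z‖ := le_max_left ‖a z‖ ‖b z‖
      have h2 : ‖b z‖ ≤ ‖(a.prod b) z‖ := le_max_right ‖a z‖ ‖b z‖
      refine abs_le_of_sq_le_sq' ?_ (by positivity) |>.2
      rw [← hab z]
      rw [NNReal.coe_ofNat]
      have h3 := pow_le_pow_left₀ (norm_nonneg _) h1 2
      have h4 := pow_le_pow_left₀ (norm_nonneg _) h2 2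
      rw [mul_pow]
      linarith [sq_nonneg ‖(a.prod b) z‖]
    · intro p hp
      obtain ⟨z, rfl⟩ := (mem_graph_quotOp ha).1 hp
      refine hn.induction (P := fun z => (a z, b z) ∈ (quotOp A B).graph.topologicalClosure)
        ?_ ?_ z
      · rintro _ ⟨y, rfl⟩
        rw [haA, hbB]
        exact Submodule.le_topologicalClosure _ ((mem_graph_quotOp hA).2 ⟨y, rfl⟩)
      · exact (Submodule.isClosed_topologicalClosure _).preimage
          (a.continuous.prodMk b.continuous)
  have hclosable : (quotOp A B).IsClosable := ⟨_, hcl⟩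
  obtain ⟨U, w, E, D, hE, hD, hE0, hD0, hED, h1, hpos, haw, hbw, hcomm⟩ :=
    exists_polar_bounded hab ha hb had hbd
  refine ⟨hclosable, U, quotOp E D, ⟨isSelfAdjoint_quotOp hE hD hE0 hED h1, ?_, ?_, ?_, ?_⟩, ?_⟩
  · intro x
    obtain ⟨z, hz⟩ := (mem_graph_quotOp hE0).1 (LinearPMap.mem_graph (quotOp E D) x)
    rw [Prod.mk.injEq] at hz
    rw [hz.1, hz.2]
    exact hpos z
  · refine LinearPMap.eq_of_eq_graph ?_
    rw [← hclosable.graph_closure_eq_closure_graph, hcl]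
    ext p
    rw [mem_graph_quotOp ha, mem_graph_compPMap]
    constructor
    · rintro ⟨z, rfl⟩
      obtain ⟨x, rfl⟩ := w.surjective z
      exact ⟨D x, (mem_graph_quotOp hE0).2 ⟨x, by rw [haw]⟩, (hbw x).symm⟩
    · rintro ⟨y, hy, hUy⟩
      obtain ⟨x, hx⟩ := (mem_graph_quotOp hE0).1 hy
      rw [Prod.mk.injEq] at hx
      refine ⟨w x, Prod.ext ?_ ?_⟩
      · exact hx.1.trans (haw x).symm
      · rw [← hUy, hx.2]
        exact (hbw x).symm
  · intro x _
    exact U.norm_map x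
  · intro x hx
    -- D is injective and positive, so the modulus has dense range and the vanishing condition
    -- concerns only x = 0.
    have : x = 0 := eq_zero_of_denseRange (denseRange_of_isPositive hD hD0) fun y => by
      obtain ⟨y', h1, h2⟩ := LinearPMap.mem_graph_iff _ |>.1
        ((mem_graph_quotOp (B := D) hE0).2 ⟨y, rfl⟩)
      simp only at h2
      rw [← h2]
      exact hx y'
    rw [this, map_zero]
  · intro T T' L hT hT' hAL hBL
    -- L need not be selfadjoint. The operator a* T a + b* T' b is, and a* a + b* b = 1 gives M n =
    -- n L, so M carries the intertwining from A, B over to a, b.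
    set M : H →L[ℝ] H := (ContinuousLinearMap.adjoint a).comp (T.comp a) +
      (ContinuousLinearMap.adjoint b).comp (T'.comp b)
    have haabb : ∀ z, ContinuousLinearMap.adjoint a (a z) + ContinuousLinearMap.adjoint b (b z)
        = z := by
      -- A symmetric operator whose quadratic form vanishes is zero.
      have h0 : (ContinuousLinearMap.adjoint a).comp a + (ContinuousLinearMap.adjoint b).comp b
          - 1 = 0 := by
        have hs := ((ContinuousLinearMap.isPositive_adjoint_comp_self a).add
          (ContinuousLinearMap.isPositive_adjoint_comp_self b)).isSelfAdjoint.sub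
          (IsSelfAdjoint.one _)
        refine ContinuousLinearMap.coe_injective
          ((ContinuousLinearMap.isSelfAdjoint_iff_isSymmetric.1 hs).inner_map_self_eq_zero.1
          fun z => ?_)
        change inner ℝ (ContinuousLinearMap.adjoint a (a z) + ContinuousLinearMap.adjoint b (b z)
          - z) z = 0
        rw [inner_sub_left, inner_add_left, ContinuousLinearMap.adjoint_inner_left,
          ContinuousLinearMap.adjoint_inner_left, real_inner_self_eq_norm_sq,
          real_inner_self_eq_norm_sq, real_inner_self_eq_norm_sq, hab, sub_self]
      intro z
      exact sub_eq_zero.1 (DFunLike.congr_fun h0 z)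
    have hMs : IsSelfAdjoint M := by
      have e1 := hT.adjoint_conj a
      have e2 := hT'.adjoint_conj b
      exact e1.add e2
    have hMn : ∀ x, M (n x) = n (L x) := fun x => by
      change ContinuousLinearMap.adjoint a (T (a (n x))) +
        ContinuousLinearMap.adjoint b (T' (b (n x))) = _
      rw [haA, hbB, ← hAL, ← hBL, ← haA, ← hbB, haabb]
    refine hcomm T T' M hT hT' hMs (fun x => ?_) fun x => ?_
    · refine hn.induction (P := fun x => a (M x) = T (a x)) ?_ ?_ x
      · rintro _ ⟨y, rfl⟩
        rw [hMn, haA, haA, hAL]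
      · exact isClosed_eq (by fun_prop) (by fun_prop)
    · refine hn.induction (P := fun x => b (M x) = T' (b x)) ?_ ?_ x
      · rintro _ ⟨y, rfl⟩
        rw [hMn, hbB, hbB, hBL]
      · exact isClosed_eq (by fun_prop) (by fun_prop)

theorem sqrtOp_eq_zero_imp {C : H →L[ℝ] H} (hC : C.IsPositive) (hinj : Function.Injective C) (x : H)
    (hx : sqrtOp C x = 0) : x = 0 := by
  refine hinj ?_
  rw [map_zero]
  nth_rewrite 1 [← (sqrtOp_spec hC).2]
  rw [ContinuousLinearMap.comp_apply, hx, map_zero]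

theorem denseRange_sqrtOp {C : H →L[ℝ] H} (hC : C.IsPositive) (hinj : Function.Injective C) :
    DenseRange (sqrtOp C) :=
  denseRange_of_isPositive (sqrtOp_spec hC).1 (sqrtOp_eq_zero_imp hC hinj)

end Polar

/-! ### Strong continuity of the adjoint semigroup -/

section Semigroup

theorem tendsto_inv_smul_integral {E : Type*} [NormedAddCommGroup E] [NormedSpace ℝ E]
    [CompleteSpace E] {f : ℝ → E} (hf : ContinuousOn f (Ici 0)) :
    Tendsto (fun t : ℝ => t⁻¹ • ∫ s in (0 : ℝ)..t, f s) (𝓝[>] 0) (𝓝 (f 0)) := by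
  have h := intervalIntegral.integral_hasDerivWithinAt_right (a := (0 : ℝ)) (b := 0) (f := f)
    (s := Ici 0) (t := Ioi 0) (by simp)
    ((hf.mono Ioi_subset_Ici_self).stronglyMeasurableAtFilter_nhdsWithin measurableSet_Ioi 0)
    ((hf 0 self_mem_Ici).mono Ioi_subset_Ici_self)
  rw [hasDerivWithinAt_iff_tendsto_slope] at h
  have e : (Ici (0 : ℝ) \ {0}) = Ioi 0 := Ici_sdiff_left
  rw [e] at h
  refine h.congr fun t => ?_
  simp [slope_def_module]

variable {H : Type*} [NormedAddCommGroup H] [InnerProductSpace ℝ H] [CompleteSpace H]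
  {S : ℝ → H →L[ℝ] H}

theorem IsC0Semigroup.exists_bound (hS : IsC0Semigroup S) (b : ℝ) :
    ∃ M : ℝ, 0 ≤ M ∧ ∀ t, 0 ≤ t → t ≤ b → ‖S t‖ ≤ M := by
  obtain ⟨C, hC⟩ := banach_steinhaus (g := fun t : Icc (0 : ℝ) b => S t) (fun x => by
    obtain ⟨C, hC⟩ := isCompact_Icc.exists_bound_of_continuousOn
      ((hS.continuousOn x).mono (fun t (ht : t ∈ Icc 0 b) => ht.1))
    exact ⟨C, fun i => hC i i.2⟩)
  exact ⟨max C 0, le_max_right _ _, fun t h0 hb => (hC ⟨t, h0, hb⟩).trans (le_max_left _ _)⟩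

theorem IsC0Semigroup.continuousOn_apply (hS : IsC0Semigroup S) {v : ℝ → H}
    (hv : ContinuousOn v (Ici 0)) : ContinuousOn (fun t => S t (v t)) (Ici 0) := by
  intro t ht
  obtain ⟨M, hM0, hM⟩ := hS.exists_bound (t + 1)
  have h1 : Tendsto (fun s => M * ‖v s - v t‖ + ‖S s (v t) - S t (v t)‖) (𝓝[Ici 0] t) (𝓝 0) := by
    have h2 := ((hv t ht).sub_const (v t)).norm.const_mul M
    have h3 := (((hS.continuousOn (v t)) t ht).sub_const (S t (v t))).norm
    simpa using h2.add h3
  rw [ContinuousWithinAt, tendsto_iff_norm_sub_tendsto_zero]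
  refine squeeze_zero' (Eventually.of_forall fun _ => norm_nonneg _) ?_ h1
  have h4 : ∀ᶠ s in 𝓝[Ici 0] t, s < t + 1 :=
    mem_nhdsWithin_of_mem_nhds (Iio_mem_nhds (by linarith))
  filter_upwards [h4, self_mem_nhdsWithin] with s hs hs0
  have : S s (v s) - S t (v t) = S s (v s - v t) + (S s (v t) - S t (v t)) := by
    rw [map_sub]; abel
  rw [this]
  refine (norm_add_le _ _).trans (add_le_add_left ?_ _)
  exact (S s).le_of_opNorm_le (hM s hs0 hs.le) _

theorem IsC0Semigroup.intervalIntegrable (hS : IsC0Semigroup S) (z : H) {a b : ℝ} (ha : 0 ≤ a)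
    (hb : 0 ≤ b) : IntervalIntegrable (fun s => S s z) volume a b :=
  ((hS.continuousOn z).mono fun _ hs => (le_min ha hb).trans hs.1).intervalIntegrable

theorem IsC0Semigroup.exists_integral_operator (hS : IsC0Semigroup S) {e : ℝ} (he : 0 ≤ e) :
    ∃ J : H →L[ℝ] H, ∀ z, J z = ∫ s in (0 : ℝ)..e, S s z := by
  obtain ⟨M, hM0, hM⟩ := hS.exists_bound e
  refine ⟨LinearMap.mkContinuous
    { toFun := fun z => ∫ s in (0 : ℝ)..e, S s z
      map_add' := fun x y => by
        simp only [_root_.map_add]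
        exact intervalIntegral.integral_add (hS.intervalIntegrable x le_rfl he)
          (hS.intervalIntegrable y le_rfl he)
      map_smul' := fun c x => by
        simp only [map_smul]
        exact intervalIntegral.integral_smul c _ } (M * e) fun z => ?_, fun z => rfl⟩
  have := intervalIntegral.norm_integral_le_of_norm_le_const (a := 0) (b := e)
    (f := fun s => S s z) (C := M * ‖z‖) fun s hs => by
      rw [uIoc_of_le he] at hs
      exact (S s).le_of_opNorm_le (hM s hs.1.le hs.2) z
  rw [sub_zero, abs_of_nonneg he] at this
  change ‖∫ s in (0 : ℝ)..e, S s z‖ ≤ _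
  linarith

/-- The semigroup law turns the first integral into one over [t, e + t], which differs from [0, e]
by two intervals of length t. -/
theorem IsC0Semigroup.norm_integral_shift_le (hS : IsC0Semigroup S) {M e t : ℝ} (ht : 0 ≤ t)
    (he : 0 ≤ e) (hM : ∀ s, 0 ≤ s → s ≤ e + t → ‖S s‖ ≤ M) (z : H) :
    ‖(∫ s in (0 : ℝ)..e, S s (S t z)) - ∫ s in (0 : ℝ)..e, S s z‖ ≤ 2 * M * t * ‖z‖ := by
  have h1 : (∫ s in (0 : ℝ)..e, S s (S t z)) = ∫ s in t..(e + t), S s z := by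
    have := intervalIntegral.integral_comp_add_right (a := 0) (b := e) (fun s => S s z) t
    rw [zero_add] at this
    rw [← this]
    refine intervalIntegral.integral_congr fun s hs => ?_
    rw [uIcc_of_le he] at hs
    rw [hS.map_add s t hs.1 ht]
    rfl
  rw [h1, intervalIntegral.integral_interval_sub_interval_comm
    (hS.intervalIntegrable z ht (by linarith)) (hS.intervalIntegrable z le_rfl he)
    (hS.intervalIntegrable z ht le_rfl)]
  have h2 := intervalIntegral.norm_integral_le_of_norm_le_const (a := t) (b := 0)
    (f := fun s => S s z) (C := M * ‖z‖) fun s hs => by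
      rw [uIoc_of_ge ht] at hs
      exact (S s).le_of_opNorm_le (hM s hs.1.le (by linarith [hs.2])) z
  have h3 := intervalIntegral.norm_integral_le_of_norm_le_const (a := e + t) (b := e)
    (f := fun s => S s z) (C := M * ‖z‖) fun s hs => by
      rw [uIoc_of_ge (by linarith)] at hs
      exact (S s).le_of_opNorm_le (hM s (by linarith [hs.1]) hs.2) z
  rw [zero_sub, abs_neg, abs_of_nonneg ht] at h2
  rw [show e - (e + t) = -t by ring, abs_neg, abs_of_nonneg ht] at h3
  refine (norm_sub_le _ _).trans ((add_le_add h2 h3).trans (le_of_eq (by ring)))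

theorem IsC0Semigroup.norm_adjoint_le (M : ℝ) {t : ℝ} (h : ‖S t‖ ≤ M) (x : H) :
    ‖(S t).adjoint x‖ ≤ M * ‖x‖ :=
  ContinuousLinearMap.le_of_opNorm_le _ (by rwa [ContinuousLinearMap.adjoint.norm_map]) x

/-- With J_e = ∫₀ᵉ S(s) ds, the operators J_e S(t) - J_e are O(t) in norm, so S(t)* converges on the
ranges of the J_e*. A vector y orthogonal to these ranges satisfies J_e y = 0, whence y = lim e⁻¹
J_e y = 0. Density and the local bound on ‖S(t)*‖ finish the argument. -/
theorem IsC0Semigroup.tendsto_adjoint (hS : IsC0Semigroup S) (x : H) :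
    Tendsto (fun t => (S t).adjoint x) (𝓝[≥] 0) (𝓝 x) := by
  -- Times up to e + t occur, with e ≤ 1 and t < 1.
  obtain ⟨M, hM0, hM⟩ := hS.exists_bound 2
  let N : Submodule ℝ H :=
    { carrier := {x | Tendsto (fun t => (S t).adjoint x) (𝓝[≥] 0) (𝓝 x)}
      add_mem' := fun {a b} ha hb => by
        simpa only [mem_ofPred_eq, _root_.map_add] using Tendsto.add ha hb
      zero_mem' := by simp
      smul_mem' := fun c a ha => by
        simpa only [mem_ofPred_eq, map_smul] using Tendsto.const_smul ha c }
  have h1 : ∀ᶠ t : ℝ in 𝓝[≥] 0, 0 ≤ t ∧ t < 1 := by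
    filter_upwards [self_mem_nhdsWithin, mem_nhdsWithin_of_mem_nhds (Iio_mem_nhds one_pos)]
      with t h1 h2 using ⟨h1, h2⟩
  have hJ : ∀ (e : ℝ) (J : H →L[ℝ] H), 0 ≤ e → e ≤ 1 → (∀ z, J z = ∫ s in (0 : ℝ)..e, S s z) →
      ∀ x, J.adjoint x ∈ N := by
    intro e J he he1 hJ x
    change Tendsto _ _ _
    rw [tendsto_iff_norm_sub_tendsto_zero]
    have h2 : Tendsto (fun t : ℝ => 2 * M * t * ‖x‖) (𝓝[≥] 0) (𝓝 0) := by
      have : Continuous fun t : ℝ => 2 * M * t * ‖x‖ := by fun_prop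
      simpa using (this.tendsto 0).mono_left nhdsWithin_le_nhds
    refine squeeze_zero' (Eventually.of_forall fun _ => norm_nonneg _) ?_ h2
    filter_upwards [h1] with t ht
    have h3 : ‖J.comp (S t) - J‖ ≤ 2 * M * t := by
      refine ContinuousLinearMap.opNorm_le_bound _ (by have := ht.1; positivity) fun z => ?_
      change ‖J (S t z) - J z‖ ≤ _
      rw [hJ, hJ]
      exact hS.norm_integral_shift_le ht.1 he
        (fun s hs0 hs => hM s hs0 (by linarith [ht.2])) z
    have h4 : (S t).adjoint (J.adjoint x) - J.adjoint x =
        (J.comp (S t) - J).adjoint x := by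
      rw [map_sub, ContinuousLinearMap.adjoint_comp]
      rfl
    rw [h4]
    exact ContinuousLinearMap.le_of_opNorm_le _
      (by rwa [ContinuousLinearMap.adjoint.norm_map]) x
  have hNd : N.topologicalClosure = ⊤ := by
    rw [Submodule.topologicalClosure_eq_top_iff, Submodule.eq_bot_iff]
    intro y hy
    have h2 := tendsto_inv_smul_integral (hS.continuousOn y)
    rw [hS.map_zero] at h2
    refine tendsto_nhds_unique h2 (tendsto_const_nhds.congr' ?_)
    filter_upwards [Ioo_mem_nhdsGT one_pos] with e he
    obtain ⟨J, hJe⟩ := hS.exists_integral_operator he.1.le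
    rw [← hJe]
    have : J y = 0 := by
      refine ext_inner_left ℝ fun z => ?_
      rw [← ContinuousLinearMap.adjoint_inner_left, inner_zero_right]
      exact (Submodule.mem_orthogonal _ _).1 hy _ (hJ e J he.1.le he.2.le hJe z)
    rw [this, smul_zero]
  rw [Metric.tendsto_nhds]
  intro ε hε
  have hx : x ∈ closure (N : Set H) := by
    rw [← Submodule.topologicalClosure_coe, hNd]; trivial
  -- The terms S(t)*(x - x') and x - x' together cost (M + 1) ‖x - x'‖ < ε/2.
  obtain ⟨x', hx', hxx'⟩ := Metric.mem_closure_iff.1 hx (ε / (2 * (M + 1))) (by positivity)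
  have h2 := Metric.tendsto_nhds.1 (show Tendsto _ _ _ from hx') (ε / 2) (by positivity)
  filter_upwards [h1, h2] with t ht h3
  rw [dist_eq_norm] at h3 hxx' ⊢
  have h4 : (S t).adjoint x - x = (S t).adjoint (x - x') + ((S t).adjoint x' - x') - (x - x') := by
    rw [map_sub]; abel
  have h5 := IsC0Semigroup.norm_adjoint_le M (hM t ht.1 (by linarith [ht.2])) (x - x')
  rw [h4]
  refine (norm_sub_le _ _).trans_lt ((add_le_add_left (norm_add_le _ _) _).trans_lt ?_)
  rw [lt_div_iff₀ (by positivity)] at hxx'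
  nlinarith

/-- Factoring out the smaller time gives ‖S(s)* x - S(t)* x‖ ≤ M ‖S(|s - t|)* x - x‖, which reduces
the claim to time 0 from both sides. -/
theorem IsC0Semigroup.continuousOn_adjoint (hS : IsC0Semigroup S) (x : H) :
    ContinuousOn (fun t => (S t).adjoint x) (Ici 0) := by
  intro t ht
  obtain ⟨M, hM0, hM⟩ := hS.exists_bound (t + 1)
  have hadd : ∀ s r : ℝ, 0 ≤ s → 0 ≤ r →
      (S (s + r)).adjoint x = (S s).adjoint ((S r).adjoint x) := by
    intro s r hs hr
    rw [add_comm, hS.map_add r s hr hs, ContinuousLinearMap.adjoint_comp]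
    rfl
  have h0 : Tendsto (fun s : ℝ => |s - t|) (𝓝[Ici 0] t) (𝓝[≥] 0) := by
    refine tendsto_nhdsWithin_iff.2 ⟨?_, Eventually.of_forall fun s => mem_Ici.2 (abs_nonneg _)⟩
    have : Continuous fun s : ℝ => |s - t| := by fun_prop
    simpa using (this.tendsto t).mono_left nhdsWithin_le_nhds
  have h1 : Tendsto (fun s : ℝ => M * ‖(S |s - t|).adjoint x - x‖) (𝓝[Ici 0] t) (𝓝 0) := by
    simpa using (((hS.tendsto_adjoint x).comp h0).sub_const x).norm.const_mul M
  rw [ContinuousWithinAt, tendsto_iff_norm_sub_tendsto_zero]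
  refine squeeze_zero' (Eventually.of_forall fun _ => norm_nonneg _) ?_ h1
  have h4 : ∀ᶠ s in 𝓝[Ici 0] t, s < t + 1 :=
    mem_nhdsWithin_of_mem_nhds (Iio_mem_nhds (by linarith))
  filter_upwards [h4, self_mem_nhdsWithin] with s hs hs0
  rcases le_total s t with hst | hst
  · have := hadd s (t - s) hs0 (by linarith)
    rw [add_sub_cancel] at this
    rw [this, ← map_sub, abs_sub_comm, abs_of_nonneg (by linarith)]
    refine (IsC0Semigroup.norm_adjoint_le M (hM s hs0 hs.le) _).trans_eq ?_
    rw [norm_sub_rev]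
  · have := hadd t (s - t) ht (by linarith)
    rw [add_sub_cancel] at this
    rw [this, ← map_sub, abs_of_nonneg (by linarith)]
    exact IsC0Semigroup.norm_adjoint_le M (hM t ht (by linarith)) _

theorem IsC0Semigroup.continuousOn_cov (hS : IsC0Semigroup S) (Q : H →L[ℝ] H) (x : H) :
    ContinuousOn (fun t => S t (Q ((S t).adjoint x))) (Ici 0) :=
  hS.continuousOn_apply (Q.continuous.comp_continuousOn (hS.continuousOn_adjoint x))

end Semigroup

/-! ### The covariance operators Q_t: existence, trace class, and the flow identity -/

section Covariance

variable {H : Type*} [NormedAddCommGroup H] [InnerProductSpace ℝ H] [CompleteSpace H]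

/-- Orthonormal vectors lie at distance √2, so balls of radius 1/2 around them are disjoint open
sets in a separable space. -/
theorem countable_exists_hilbertBasis_choose [SecondCountableTopology H] :
    ((exists_hilbertBasis ℝ H).choose).Countable := by
  set w := (exists_hilbertBasis ℝ H).choose
  set b := (exists_hilbertBasis ℝ H).choose_spec.choose
  have hb : ⇑b = Subtype.val := (exists_hilbertBasis ℝ H).choose_spec.choose_spec
  have ho := b.orthonormal
  refine Set.PairwiseDisjoint.countable_of_isOpen (s := fun x : H => Metric.ball x (1 / 2)) ?_
    (fun _ _ => Metric.isOpen_ball) (fun x _ => ⟨x, Metric.mem_ball_self (by norm_num)⟩)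
  intro x hx y hy hxy
  refine Metric.ball_disjoint_ball ?_
  have hbx : ∀ z (hz : z ∈ w), b ⟨z, hz⟩ = z := fun z hz => by rw [hb]
  have h0 : inner ℝ x y = 0 := by
    have : inner ℝ (b ⟨x, hx⟩) (b ⟨y, hy⟩) = 0 := ho.2 (fun h => hxy (congrArg Subtype.val h))
    rwa [hbx, hbx] at this
  have h1 : ‖x‖ = 1 := by have := ho.1 ⟨x, hx⟩; rwa [hbx] at this
  have h2 : ‖y‖ = 1 := by have := ho.1 ⟨y, hy⟩; rwa [hbx] at this
  have h3 := norm_sub_sq_real x y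
  rw [h0, h1, h2] at h3
  rw [dist_eq_norm]
  nlinarith [norm_nonneg (x - y)]

/-- The trace of X X* is the squared Hilbert-Schmidt norm Σ ‖X* bᵢ‖². By Parseval ‖X y‖² = Σ ⟨X* bᵢ,
y⟩², and Cauchy-Schwarz bounds each term. -/
theorem enorm_comp_adjoint_le_opTrace (X : H →L[ℝ] H) :
    ‖X.comp X.adjoint‖ₑ ≤ opTrace (X.comp X.adjoint) := by
  unfold opTrace
  set w := (exists_hilbertBasis ℝ H).choose
  set b : HilbertBasis w ℝ H := (exists_hilbertBasis ℝ H).choose_spec.choose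
  have hterm : ∀ i, inner ℝ ((X.comp X.adjoint) (b i)) (b i) = ‖X.adjoint (b i)‖ ^ 2 := fun i => by
    rw [← real_inner_self_eq_norm_sq, ContinuousLinearMap.adjoint_inner_right]; rfl
  simp_rw [hterm]
  by_cases ht : ∑' i, ENNReal.ofReal (‖X.adjoint (b i)‖ ^ 2) = ⊤
  · rw [ht]; exact le_top
  have hsum : Summable fun i => ‖X.adjoint (b i)‖ ^ 2 := by
    have := ENNReal.summable_toReal ht
    refine this.congr fun i => ENNReal.toReal_ofReal (sq_nonneg _)
  rw [← ENNReal.ofReal_tsum_of_nonneg (fun i => sq_nonneg _) hsum]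
  set τ := ∑' i, ‖X.adjoint (b i)‖ ^ 2
  have hτ : 0 ≤ τ := tsum_nonneg fun i => sq_nonneg _
  have hX : ‖X‖ ≤ √τ := by
    refine ContinuousLinearMap.opNorm_le_bound _ (Real.sqrt_nonneg _) fun y => ?_
    have h1 := b.hasSum_inner_mul_inner (X y) (X y)
    rw [real_inner_self_eq_norm_sq] at h1
    have h2 : ‖X y‖ ^ 2 ≤ τ * ‖y‖ ^ 2 := by
      refine hasSum_le (fun i => ?_) h1 (hsum.hasSum.mul_right (‖y‖ ^ 2))
      rw [real_inner_comm (b i), ← pow_two, ← ContinuousLinearMap.adjoint_inner_left, ← mul_pow]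
      exact sq_le_sq' (neg_le_of_abs_le (abs_real_inner_le_norm (X.adjoint (b i)) y))
        (real_inner_le_norm _ _)
    refine abs_le_of_sq_le_sq' ?_ (by positivity) |>.2
    rwa [mul_pow, Real.sq_sqrt hτ]
  rw [← ofReal_norm]
  refine ENNReal.ofReal_le_ofReal ?_
  refine (ContinuousLinearMap.opNorm_comp_le _ _).trans ?_
  rw [ContinuousLinearMap.adjoint.norm_map]
  calc ‖X‖ * ‖X‖ ≤ √τ * √τ := mul_le_mul hX hX (norm_nonneg _) (Real.sqrt_nonneg _)
    _ = τ := Real.mul_self_sqrt hτ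

/-- Finiteness of `∫₀^∞ tr (S(s) Q S(s)*) ds`. -/
def HasFiniteTrace (S : ℝ → H →L[ℝ] H) (Q : H →L[ℝ] H) : Prop :=
  ∫⁻ s in Ioi (0 : ℝ), opTrace ((S s).comp (Q.comp (S s).adjoint)) < ⊤

variable {S : ℝ → H →L[ℝ] H} {Q : H →L[ℝ] H}

theorem comp_adjoint_sqrtOp (hQ : Q.IsPositive) (T : H →L[ℝ] H) :
    (T.comp (sqrtOp Q)).comp (T.comp (sqrtOp Q)).adjoint = T.comp (Q.comp T.adjoint) := by
  obtain ⟨h1, h2⟩ := sqrtOp_spec hQ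
  rw [ContinuousLinearMap.adjoint_comp, h1.isSelfAdjoint.adjoint_eq]
  conv_rhs => rw [← h2]
  rfl

theorem enorm_cov_le (hQ : Q.IsPositive) (T : H →L[ℝ] H) (x : H) :
    ‖T (Q (T.adjoint x))‖ₑ ≤ opTrace (T.comp (Q.comp T.adjoint)) * ‖x‖ₑ := by
  have h1 : ‖(T.comp (Q.comp T.adjoint)) x‖ₑ ≤ ‖T.comp (Q.comp T.adjoint)‖ₑ * ‖x‖ₑ :=
    ContinuousLinearMap.le_opENorm _ x
  refine h1.trans (mul_le_mul_left ?_ _)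
  rw [← comp_adjoint_sqrtOp hQ]
  exact enorm_comp_adjoint_le_opTrace _

theorem lintegral_enorm_cov_le (hQ : Q.IsPositive) (x : H) :
    ∫⁻ s in Ioi (0 : ℝ), ‖S s (Q ((S s).adjoint x))‖ₑ ≤
      (∫⁻ s in Ioi (0 : ℝ), opTrace ((S s).comp (Q.comp (S s).adjoint))) * ‖x‖ₑ := by
  rw [← lintegral_mul_const' _ _ enorm_ne_top]
  exact lintegral_mono fun s => enorm_cov_le hQ (S s) x

theorem integrableOn_cov (hS : IsC0Semigroup S) (hQ : Q.IsPositive) (htr : HasFiniteTrace S Q)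
    (x : H) : IntegrableOn (fun s => S s (Q ((S s).adjoint x))) (Ioi 0) := by
  refine ⟨((hS.continuousOn_cov Q x).mono Ioi_subset_Ici_self).aestronglyMeasurable
    measurableSet_Ioi, ?_⟩
  exact (lintegral_enorm_cov_le hQ x).trans_lt (ENNReal.mul_lt_top htr enorm_lt_top)

theorem setOf_pos_le_subset (t : EReal) : {s : ℝ | 0 < s ∧ (s : EReal) ≤ t} ⊆ Ioi 0 :=
  fun _ hs => hs.1

theorem covOp_apply (hS : IsC0Semigroup S) (hQ : Q.IsPositive) (htr : HasFiniteTrace S Q)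
    (t : EReal) (x : H) :
    covOp S Q t x = ∫ s in {s : ℝ | 0 < s ∧ (s : EReal) ≤ t}, S s (Q ((S s).adjoint x)) := by
  have hint := fun x => (integrableOn_cov hS hQ htr x).mono_set (setOf_pos_le_subset t)
  refine described_spec (p := fun T : H →L[ℝ] H => ∀ x : H,
    T x = ∫ s in {s : ℝ | 0 < s ∧ (s : EReal) ≤ t}, S s (Q ((S s).adjoint x))) ⟨?_, ?_⟩ x
  · refine LinearMap.mkContinuous
      { toFun := fun x => ∫ s in {s : ℝ | 0 < s ∧ (s : EReal) ≤ t}, S s (Q ((S s).adjoint x))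
        map_add' := fun x y => by
          simp only [map_add]
          exact integral_add (hint x) (hint y)
        map_smul' := fun c x => by
          simp only [map_smul]
          exact integral_smul c _ }
      (∫⁻ s in Ioi (0 : ℝ), opTrace ((S s).comp (Q.comp (S s).adjoint))).toReal fun x => ?_
    have h1 : ‖∫ s in {s : ℝ | 0 < s ∧ (s : EReal) ≤ t}, S s (Q ((S s).adjoint x))‖ₑ ≤
        (∫⁻ s in Ioi (0 : ℝ), opTrace ((S s).comp (Q.comp (S s).adjoint))) * ‖x‖ₑ :=
      (enorm_integral_le_lintegral_enorm _).trans
        ((lintegral_mono_set (setOf_pos_le_subset t)).trans (lintegral_enorm_cov_le hQ x))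
    have h2 := ENNReal.toReal_mono (ENNReal.mul_lt_top htr enorm_lt_top).ne h1
    rwa [ENNReal.toReal_mul, toReal_enorm, toReal_enorm] at h2
  · exact fun x => rfl

theorem covOp_top_apply (hS : IsC0Semigroup S) (hQ : Q.IsPositive) (htr : HasFiniteTrace S Q)
    (x : H) : covOp S Q ⊤ x = ∫ s in Ioi (0 : ℝ), S s (Q ((S s).adjoint x)) := by
  rw [covOp_apply hS hQ htr]
  congr 2
  ext s
  simp

theorem covOp_coe_apply (hS : IsC0Semigroup S) (hQ : Q.IsPositive) (htr : HasFiniteTrace S Q)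
    (t : ℝ) (x : H) : covOp S Q t x = ∫ s in Ioc (0 : ℝ) t, S s (Q ((S s).adjoint x)) := by
  rw [covOp_apply hS hQ htr]
  congr 2
  ext s
  simp

theorem inner_covOp (hS : IsC0Semigroup S) (hQ : Q.IsPositive) (htr : HasFiniteTrace S Q)
    (t : EReal) (x y : H) : inner ℝ (covOp S Q t x) y =
      ∫ s in {s : ℝ | 0 < s ∧ (s : EReal) ≤ t},
        inner ℝ (sqrtOp Q ((S s).adjoint x)) (sqrtOp Q ((S s).adjoint y)) := by
  obtain ⟨h1, h2⟩ := sqrtOp_spec hQ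
  rw [covOp_apply hS hQ htr, real_inner_comm, ← integral_inner
    ((integrableOn_cov hS hQ htr x).mono_set (setOf_pos_le_subset t))]
  refine integral_congr_ae (Eventually.of_forall fun s => ?_)
  change inner ℝ y (S s (Q ((S s).adjoint x))) = _
  rw [← ContinuousLinearMap.adjoint_inner_left, real_inner_comm]
  nth_rewrite 1 [← h2]
  exact h1.inner_left_eq_inner_right _ _

theorem integrableOn_norm_sq (hS : IsC0Semigroup S) (hQ : Q.IsPositive)
    (htr : HasFiniteTrace S Q) (x : H) :
    IntegrableOn (fun s => ‖sqrtOp Q ((S s).adjoint x)‖ ^ 2) (Ioi 0) := by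
  have h := (integrableOn_cov hS hQ htr x).const_inner (𝕜 := ℝ) x
  refine h.congr (Eventually.of_forall fun s => ?_)
  obtain ⟨h1, h2⟩ := sqrtOp_spec hQ
  change inner ℝ x (S s (Q ((S s).adjoint x))) = ‖sqrtOp Q ((S s).adjoint x)‖ ^ 2
  rw [norm_sq_eq_inner_of_comp_self h1 h2, ← ContinuousLinearMap.adjoint_inner_left,
    real_inner_comm]

theorem inner_covOp_self (hS : IsC0Semigroup S) (hQ : Q.IsPositive) (htr : HasFiniteTrace S Q)
    (t : EReal) (x : H) : inner ℝ (covOp S Q t x) x =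
      ∫ s in {s : ℝ | 0 < s ∧ (s : EReal) ≤ t}, ‖sqrtOp Q ((S s).adjoint x)‖ ^ 2 := by
  rw [inner_covOp hS hQ htr]
  simp_rw [real_inner_self_eq_norm_sq]

theorem isPositive_covOp (hS : IsC0Semigroup S) (hQ : Q.IsPositive) (htr : HasFiniteTrace S Q)
    (t : EReal) : (covOp S Q t).IsPositive := by
  rw [ContinuousLinearMap.isPositive_iff']
  constructor
  · rw [ContinuousLinearMap.isSelfAdjoint_iff_isSymmetric]
    intro x y
    change inner ℝ (covOp S Q t x) y = inner ℝ x (covOp S Q t y)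
    rw [real_inner_comm (covOp S Q t y) x, inner_covOp hS hQ htr, inner_covOp hS hQ htr]
    simp_rw [fun s => real_inner_comm (sqrtOp Q ((S s).adjoint x)) (sqrtOp Q ((S s).adjoint y))]
  · intro x
    rw [inner_covOp_self hS hQ htr]
    exact integral_nonneg fun s => sq_nonneg _

/-- Trace and time integral are exchanged by Tonelli, which needs the basis to be countable; the
integral up to t is then at most the full one. -/
theorem opTrace_covOp_lt_top [SecondCountableTopology H] (hS : IsC0Semigroup S)
    (hQ : Q.IsPositive) (htr : HasFiniteTrace S Q) (t : EReal) : opTrace (covOp S Q t) < ⊤ := by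
  refine lt_of_le_of_lt ?_ htr
  unfold opTrace
  set w := (exists_hilbertBasis ℝ H).choose
  set b : HilbertBasis w ℝ H := (exists_hilbertBasis ℝ H).choose_spec.choose
  have : Countable w := countable_exists_hilbertBasis_choose (H := H)
  obtain ⟨h1, h2⟩ := sqrtOp_spec hQ
  have e : ∀ s i, inner ℝ (((S s).comp (Q.comp (S s).adjoint)) (b i)) (b i) =
      ‖sqrtOp Q ((S s).adjoint (b i))‖ ^ 2 := fun s i => by
    rw [norm_sq_eq_inner_of_comp_self h1 h2, ContinuousLinearMap.adjoint_inner_right]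
    rfl
  simp_rw [e]
  rw [lintegral_tsum fun i =>
    (integrableOn_norm_sq hS hQ htr (b i)).aestronglyMeasurable.aemeasurable.ennreal_ofReal]
  refine ENNReal.tsum_le_tsum fun i => ?_
  rw [inner_covOp_self hS hQ htr, ofReal_integral_eq_lintegral_ofReal
    ((integrableOn_norm_sq hS hQ htr (b i)).mono_set (setOf_pos_le_subset t))
    (Eventually.of_forall fun s => sq_nonneg _)]
  exact lintegral_mono_set (setOf_pos_le_subset t)

/-- The part of the integral beyond t, shifted by t, is S(t) Q_∞ S(t)*. This identity yields both
the invariance of μ and the contraction property of A S(t)* with respect to A = Q_∞^{1/2}. -/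
theorem covOp_top_eq_add (hS : IsC0Semigroup S) (hQ : Q.IsPositive) (htr : HasFiniteTrace S Q)
    {t : ℝ} (ht : 0 ≤ t) (x : H) :
    covOp S Q ⊤ x = covOp S Q t x + S t (covOp S Q ⊤ ((S t).adjoint x)) := by
  have hint := integrableOn_cov hS hQ htr x
  have hsplit : ∫ s in Ioi (0 : ℝ), S s (Q ((S s).adjoint x)) =
      (∫ s in Ioc (0 : ℝ) t, S s (Q ((S s).adjoint x))) +
        ∫ s in Ioi t, S s (Q ((S s).adjoint x)) := by
    rw [← Ioc_union_Ioi_eq_Ioi ht, setIntegral_union (Ioc_disjoint_Ioi le_rfl) measurableSet_Ioi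
      (hint.mono_set Ioc_subset_Ioi_self) (hint.mono_set (Ioi_subset_Ioi ht))]
  rw [covOp_coe_apply hS hQ htr, covOp_top_apply hS hQ htr, covOp_top_apply hS hQ htr,
    ← ContinuousLinearMap.integral_comp_comm (S t) (integrableOn_cov hS hQ htr _), hsplit]
  congr 1
  have h := (measurePreserving_add_right (volume : Measure ℝ) t).setIntegral_preimage_emb (E := H)
    (measurableEmbedding_addRight t) (fun s => S s (Q ((S s).adjoint x))) (Ioi t)
  rw [← h]
  have hp : (fun s => s + t) ⁻¹' Ioi t = Ioi 0 := by ext s; simp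
  rw [hp]
  refine setIntegral_congr_fun measurableSet_Ioi ?_
  intro s (hs : 0 < s)
  change S (s + t) (Q ((S (s + t)).adjoint x)) = S t (S s (Q ((S s).adjoint ((S t).adjoint x))))
  rw [add_comm s t, hS.map_add t s ht hs.le, ContinuousLinearMap.adjoint_comp]
  rfl

theorem inner_covOp_top_eq_add (hS : IsC0Semigroup S) (hQ : Q.IsPositive)
    (htr : HasFiniteTrace S Q) {t : ℝ} (ht : 0 ≤ t) (k : H) :
    inner ℝ (covOp S Q ⊤ k) k = inner ℝ (covOp S Q t k) k +
      inner ℝ (covOp S Q ⊤ ((S t).adjoint k)) ((S t).adjoint k) := by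
  nth_rewrite 1 [covOp_top_eq_add hS hQ htr ht]
  rw [inner_add_left, ContinuousLinearMap.adjoint_inner_right]

end Covariance

/-! ### Centered Gaussian measures: existence and moments -/

section Gaussian

theorem norm_cexp_sub_cexp_le (x y : ℝ) :
    ‖Complex.exp (x * Complex.I) - Complex.exp (y * Complex.I)‖ ≤ |x - y| := by
  have h : Complex.exp (x * Complex.I) - Complex.exp (y * Complex.I) =
      Complex.exp (y * Complex.I) * (Complex.exp (Complex.I * ((x - y : ℝ) : ℂ)) - 1) := by
    rw [mul_sub, ← Complex.exp_add, mul_one]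
    congr 2
    push_cast
    ring
  rw [h, norm_mul, Complex.norm_exp_ofReal_mul_I, one_mul]
  exact Real.norm_exp_I_mul_ofReal_sub_one_le

/-- Limits in `L²` of centered Gaussian random variables are Gaussian. -/
theorem map_eq_gaussianReal_of_tendsto {Ω ι : Type*} [MeasurableSpace Ω] {P : Measure Ω}
    [IsProbabilityMeasure P] {l : Filter ι} [l.NeBot] {f : ι → Lp ℝ 2 P} {g : Lp ℝ 2 P}
    (hfg : Tendsto f l (𝓝 g)) {v : ι → ℝ≥0} {w : ℝ≥0} (hvw : Tendsto v l (𝓝 w))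
    (hf : ∀ i, P.map (f i) = gaussianReal 0 (v i)) : P.map g = gaussianReal 0 w := by
  have hpg : IsProbabilityMeasure (P.map g) :=
    Measure.isProbabilityMeasure_map (Lp.aestronglyMeasurable g).aemeasurable
  refine Measure.ext_of_charFun ?_
  ext t
  have hint : ∀ h : Lp ℝ 2 P, Integrable (fun x => Complex.exp ((t * h x : ℝ) * Complex.I)) P := by
    intro h
    refine Integrable.of_bound (C := 1) ?_ (Eventually.of_forall fun x => by
      rw [Complex.norm_exp_ofReal_mul_I])
    have := Lp.aestronglyMeasurable h
    exact (by fun_prop : Continuous fun r : ℝ =>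
      Complex.exp ((t * r : ℝ) * Complex.I)).comp_aestronglyMeasurable this
  have hchar : ∀ h : Lp ℝ 2 P, charFun (P.map h) t =
      ∫ x, Complex.exp ((t * h x : ℝ) * Complex.I) ∂P := by
    intro h
    rw [charFun_apply_real, integral_map (Lp.aestronglyMeasurable h).aemeasurable
      (by fun_prop : Continuous fun x : ℝ => Complex.exp (t * x * Complex.I)).aestronglyMeasurable]
    simp
  -- The exponential r ↦ exp(i t r) is |t|-Lipschitz, and the L¹ norm is at most the L² norm on a
  -- probability space.
  have hle : ∀ i, ‖charFun (P.map (f i)) t - charFun (P.map g) t‖ ≤ |t| * ‖f i - g‖ := by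
    intro i
    rw [hchar, hchar, ← integral_sub (hint _) (hint _)]
    refine (norm_integral_le_integral_norm _).trans ?_
    have hm : MemLp (fun x => f i x - g x) 2 P := (Lp.memLp _).sub (Lp.memLp _)
    calc ∫ x, ‖Complex.exp ((t * f i x : ℝ) * Complex.I) -
          Complex.exp ((t * g x : ℝ) * Complex.I)‖ ∂P
        ≤ ∫ x, |t| * |f i x - g x| ∂P := by
          refine integral_mono ((hint _).sub (hint _)).norm
            ((hm.integrable one_le_two).norm.const_mul _) fun x => ?_
          refine (norm_cexp_sub_cexp_le _ _).trans_eq ?_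
          rw [← mul_sub, abs_mul]
      _ = |t| * ∫ x, |f i x - g x| ∂P := integral_const_mul _ _
      _ ≤ |t| * ‖f i - g‖ := by
          refine mul_le_mul_of_nonneg_left ?_ (abs_nonneg t)
          have h1 : ∫ x, |f i x - g x| ∂P = (eLpNorm (fun x => f i x - g x) 1 P).toReal := by
            rw [eLpNorm_one_eq_lintegral_enorm]
            exact integral_norm_eq_lintegral_enorm hm.1
          have h2 : ‖f i - g‖ = (eLpNorm (fun x => f i x - g x) 2 P).toReal := by
            rw [Lp.norm_def]
            congr 1
            exact eLpNorm_congr_ae (Lp.coeFn_sub _ _)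
          rw [h1, h2]
          exact ENNReal.toReal_mono hm.2.ne (eLpNorm_le_eLpNorm_of_exponent_le one_le_two hm.1)
  have h1 : Tendsto (fun i => charFun (P.map (f i)) t) l (𝓝 (charFun (P.map g) t)) := by
    rw [tendsto_iff_norm_sub_tendsto_zero]
    refine squeeze_zero (fun _ => norm_nonneg _) hle ?_
    simpa using ((tendsto_iff_norm_sub_tendsto_zero.1 hfg).const_mul |t|)
  refine tendsto_nhds_unique h1 ?_
  simp_rw [hf, charFun_gaussianReal]
  have hc : Continuous fun v : ℝ≥0 =>
      Complex.exp (t * ((0 : ℝ) : ℂ) * Complex.I - v * t ^ 2 / 2) := by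
    have : Continuous fun v : ℝ≥0 => ((v : ℝ) : ℂ) := Complex.continuous_ofReal.comp
      NNReal.continuous_coe
    fun_prop
  exact (hc.tendsto w).comp hvw

theorem map_sum_eq_gaussianReal {Ω ι : Type*} [MeasurableSpace Ω] {P : Measure Ω}
    [IsProbabilityMeasure P] {ξ : ι → Ω → ℝ} (hm : ∀ i, Measurable (ξ i))
    (hξ : ∀ i, P.map (ξ i) = gaussianReal 0 1) (hind : iIndepFun ξ P) (c : ι → ℝ)
    (F : Finset ι) :
    P.map (∑ i ∈ F, fun ω => c i * ξ i ω) = gaussianReal 0 (∑ i ∈ F, (c i ^ 2).toNNReal) := by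
  classical
  induction F using Finset.induction_on with
  | empty =>
    simp only [Finset.sum_empty, gaussianReal_zero_var]
    rw [show (0 : Ω → ℝ) = fun _ => 0 from rfl, Measure.map_const]
    simp
  | insert j F hj ih =>
    rw [Finset.sum_insert hj, Finset.sum_insert hj]
    have hind' : iIndepFun (fun i ω => c i * ξ i ω) P :=
      hind.comp (fun i r => c i * r) (fun i => measurable_const_mul _)
    have h1 := (hind'.indepFun_finsetSum_of_notMem (fun i => (hm i).const_mul _) hj).symm
    have h2 : P.map (fun ω => c j * ξ j ω) = gaussianReal 0 (c j ^ 2).toNNReal := by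
      have h3 := Measure.map_map (μ := P) (g := fun r : ℝ => c j * r) (measurable_const_mul _)
        (hm j)
      refine h3.symm.trans ?_
      rw [hξ, gaussianReal_map_const_mul]
      congr 1
      · simp
      · ext; simp [sq_nonneg]
    have := gaussianReal_add_gaussianReal_of_indepFun h1 h2 ih
    rwa [add_zero] at this

variable {H : Type*} [NormedAddCommGroup H] [InnerProductSpace ℝ H] [CompleteSpace H]

theorem hasSum_norm_sqrtOp_of_opTrace {C : H →L[ℝ] H} (hC : C.IsPositive)
    (htr : opTrace C < ⊤) :
    Summable fun i => ‖sqrtOp C ((exists_hilbertBasis ℝ H).choose_spec.choose i)‖ ^ 2 := by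
  obtain ⟨h1, h2⟩ := sqrtOp_spec hC
  refine (ENNReal.summable_toReal htr.ne).congr fun i => ?_
  rw [norm_sq_eq_inner_of_comp_self h1 h2, ENNReal.toReal_ofReal (hC.inner_nonneg_left _)]

/-- For a random variable `ξ` with `E ξ² = 1`, the isometry `y ↦ ξ y` of `H` into `L²(Ω; H)`. -/
noncomputable def mulIsometry {Ω : Type*} [MeasurableSpace Ω] {P : Measure Ω} {ξ : Ω → ℝ}
    (h : MemLp ξ 2 P) (h1 : ∫ ω, ξ ω * ξ ω ∂P = 1) : H →ₗᵢ[ℝ] Lp H 2 P where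
  toFun y := ((ContinuousLinearMap.toSpanSingleton ℝ y).comp_memLp' h).toLp _
  map_add' x y := by
    rw [← MemLp.toLp_add]
    congr 1
    ext ω
    simp
  map_smul' c x := by
    rw [RingHom.id_apply, ← MemLp.toLp_const_smul]
    congr 1
    ext ω
    simp [smul_comm c]
  norm_map' y := by
    refine (sq_eq_sq₀ (norm_nonneg _) (norm_nonneg _)).1 ?_
    rw [← real_inner_self_eq_norm_sq, L2.inner_def]
    have : (fun ω => inner ℝ ((((ContinuousLinearMap.toSpanSingleton ℝ y).comp_memLp' h).toLp _) ω)
        ((((ContinuousLinearMap.toSpanSingleton ℝ y).comp_memLp' h).toLp _) ω)) =ᵐ[P]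
        fun ω => ξ ω * ξ ω * ‖y‖ ^ 2 := by
      filter_upwards [MemLp.coeFn_toLp ((ContinuousLinearMap.toSpanSingleton ℝ y).comp_memLp' h)]
        with ω hω
      rw [hω]
      simp only [Function.comp_apply, ContinuousLinearMap.toSpanSingleton_apply, inner_smul_left,
        inner_smul_right, real_inner_self_eq_norm_sq, RCLike.conj_to_real]
      ring
    refine (integral_congr_ae this).trans ?_
    rw [integral_mul_const, h1, one_mul]

theorem mulIsometry_ae {Ω : Type*} [MeasurableSpace Ω] {P : Measure Ω} {ξ : Ω → ℝ}
    (h : MemLp ξ 2 P) (h1 : ∫ ω, ξ ω * ξ ω ∂P = 1) (y : H) :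
    mulIsometry h h1 y =ᵐ[P] fun ω => ξ ω • y :=
  MemLp.coeFn_toLp ((ContinuousLinearMap.toSpanSingleton ℝ y).comp_memLp' h)

/-- Existence of the Gaussian measure with a given trace class covariance. -/
theorem exists_isCenteredGaussian [MeasurableSpace H] [BorelSpace H] [SecondCountableTopology H]
    {C : H →L[ℝ] H} (hC : C.IsPositive) (htr : opTrace C < ⊤) :
    ∃ μ : Measure H, IsCenteredGaussian C μ := by
  have hsum := hasSum_norm_sqrtOp_of_opTrace hC htr
  set w := (exists_hilbertBasis ℝ H).choose
  set b : HilbertBasis w ℝ H := (exists_hilbertBasis ℝ H).choose_spec.choose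
  have : Countable w := countable_exists_hilbertBasis_choose (H := H)
  obtain ⟨hA, hA2⟩ := sqrtOp_spec hC
  set A := sqrtOp C
  obtain ⟨Ω, mΩ, P, ξ, hm, hlaw, hind, hP⟩ := exists_iid w (gaussianReal 0 1)
  have hξ : ∀ i, P.map (ξ i) = gaussianReal 0 1 := fun i => (hlaw i).map_eq
  have hL2 : ∀ i, MemLp (ξ i) 2 P := fun i => by
    have := memLp_id_gaussianReal' (μ := 0) (v := 1) 2 (by simp)
    rw [← hξ i, memLp_map_measure_iff (by fun_prop) (hm i).aemeasurable] at this
    exact this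
  have hmean : ∀ i, ∫ ω, ξ i ω ∂P = 0 := fun i => by
    have := integral_map (μ := P) (φ := ξ i) (f := fun x : ℝ => x) (hm i).aemeasurable
      (by fun_prop)
    rw [← this, hξ]
    exact integral_id_gaussianReal
  have hvar : ∀ i, ∫ ω, ξ i ω * ξ i ω ∂P = 1 := fun i => by
    have := integral_map (μ := P) (φ := ξ i) (f := fun x : ℝ => x * x) (hm i).aemeasurable
      (by fun_prop)
    rw [← this, hξ]
    have h2 := variance_id_gaussianReal (μ := 0) (v := 1)
    rw [variance_eq_sub (memLp_id_gaussianReal' 2 (by simp))] at h2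
    have h3 := integral_id_gaussianReal (μ := 0) (v := 1)
    simp only [Pi.pow_apply] at h2
    simpa [pow_two] using h2
  have horth : OrthogonalFamily ℝ (fun _ : w => H) (fun i => mulIsometry (hL2 i) (hvar i)) := by
    intro i j hij x y
    rw [L2.inner_def]
    have : (fun ω => inner ℝ (mulIsometry (hL2 i) (hvar i) x ω)
        (mulIsometry (hL2 j) (hvar j) y ω)) =ᵐ[P] fun ω => ξ i ω * ξ j ω * inner ℝ x y := by
      filter_upwards [mulIsometry_ae (hL2 i) (hvar i) x, mulIsometry_ae (hL2 j) (hvar j) y]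
        with ω h1 h2
      rw [h1, h2, inner_smul_left, inner_smul_right, RCLike.conj_to_real]
      ring
    refine (integral_congr_ae this).trans ?_
    rw [integral_mul_const]
    have h2 := (hind.indepFun hij).integral_mul_eq_mul_integral (hm i).aestronglyMeasurable
      (hm j).aestronglyMeasurable
    have h3 : ∫ ω, ξ i ω * ξ j ω ∂P = 0 := by
      refine Eq.trans h2 ?_
      rw [hmean, zero_mul]
    rw [h3, zero_mul]
  -- X = Σ ξᵢ A bᵢ with independent standard normal ξᵢ. The terms are orthogonal in L²(Ω; H), and Σ
  -- ‖A bᵢ‖² = tr C is finite.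
  obtain ⟨X, hX⟩ := (horth.summable_iff_norm_sq_summable (fun i => A (b i))).2 hsum
  refine ⟨P.map X, fun h => ?_⟩
  have hXm : AEMeasurable X P := (Lp.aestronglyMeasurable X).aemeasurable
  set L := (innerSL ℝ h).compLpL 2 P
  have hLX : L X =ᵐ[P] fun ω => inner ℝ h (X ω) := (innerSL ℝ h).coeFn_compLpL X
  rw [AEMeasurable.map_map_of_aemeasurable (by fun_prop) hXm]
  refine (Measure.map_congr hLX.symm).trans ?_
  have hLs : HasSum (fun i => L (mulIsometry (hL2 i) (hvar i) (A (b i)))) (L X) := hX.mapL L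
  have hterm : ∀ i, L (mulIsometry (hL2 i) (hvar i) (A (b i))) =ᵐ[P]
      fun ω => inner ℝ h (A (b i)) * ξ i ω := by
    intro i
    filter_upwards [(innerSL ℝ h).coeFn_compLpL (mulIsometry (hL2 i) (hvar i) (A (b i))),
      mulIsometry_ae (hL2 i) (hvar i) (A (b i))] with ω h1 h2
    rw [h1, h2, map_smul, smul_eq_mul, mul_comm]
    rfl
  -- The variance of ⟨h, X⟩ is Σ ⟨h, A bᵢ⟩² = ‖A h‖² = ⟨C h, h⟩ by Parseval.
  have hvsum : HasSum (fun i => (inner ℝ h (A (b i)) ^ 2).toNNReal)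
      (inner ℝ (C h) h).toNNReal := by
    have h1 := b.hasSum_inner_mul_inner (A h) (A h)
    rw [real_inner_self_eq_norm_sq, norm_sq_eq_inner_of_comp_self hA hA2] at h1
    rw [← NNReal.hasSum_coe, Real.coe_toNNReal _ (hC.inner_nonneg_left h)]
    have e : (fun i => ((inner ℝ h (A (b i)) ^ 2).toNNReal : ℝ)) =
        fun i => inner ℝ (A h) (b i) * inner ℝ (b i) (A h) := funext fun i => by
      rw [Real.coe_toNNReal _ (sq_nonneg _), ← hA.inner_left_eq_inner_right,
        real_inner_comm (A h) (b i), pow_two]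
    rw [e]
    exact h1
  refine map_eq_gaussianReal_of_tendsto hLs hvsum fun F => ?_
  rw [← map_sum_eq_gaussianReal hm hξ hind]
  refine Measure.map_congr ?_
  refine (Lp.coeFn_finsetSum _ _).trans ?_
  have : ∀ᵐ ω ∂P, ∀ i, L (mulIsometry (hL2 i) (hvar i) (A (b i))) ω =
      inner ℝ h (A (b i)) * ξ i ω := ae_all_iff.2 hterm
  filter_upwards [this] with ω hω
  simp only [Finset.sum_apply, hω]

variable [MeasurableSpace H] [BorelSpace H] [SecondCountableTopology H]
  {C : H →L[ℝ] H} {μ : Measure H}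

theorem isCenteredGaussian_centeredGaussian (hC : C.IsPositive) (htr : opTrace C < ⊤) :
    IsCenteredGaussian C (centeredGaussian C) :=
  described_spec (exists_isCenteredGaussian hC htr)

theorem IsCenteredGaussian.isProbabilityMeasure (h : IsCenteredGaussian C μ) :
    IsProbabilityMeasure μ := by
  have h0 := h 0
  refine ⟨?_⟩
  rw [← preimage_univ (f := fun x : H => inner ℝ (0 : H) x),
    ← Measure.map_apply (by fun_prop) MeasurableSet.univ, h0, measure_univ]

theorem IsCenteredGaussian.integral_cexp (h : IsCenteredGaussian C μ) (hC : C.IsPositive) (k : H) :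
    ∫ x, Complex.exp ((inner ℝ k x : ℝ) * Complex.I) ∂μ =
      Complex.exp (-(inner ℝ (C k) k : ℝ) / 2) := by
  have h1 := charFun_gaussianReal (μ := 0) (v := (inner ℝ (C k) k).toNNReal) 1
  rw [← h k, charFun_apply_real, integral_map (by fun_prop) (by fun_prop)] at h1
  simp only [Complex.ofReal_one, one_mul, Complex.ofReal_zero, zero_mul, mul_one, one_pow,
    zero_sub, Real.coe_toNNReal _ (hC.inner_nonneg_left k)] at h1
  rw [h1, neg_div]

theorem IsCenteredGaussian.memLp_inner (h : IsCenteredGaussian C μ) (k : H) :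
    MemLp (fun x => inner ℝ k x) 2 μ := by
  have := memLp_id_gaussianReal' (μ := 0) (v := (inner ℝ (C k) k).toNNReal) 2 (by simp)
  rwa [← h k, memLp_map_measure_iff (by fun_prop) (by fun_prop)] at this

theorem IsCenteredGaussian.integral_inner_sq (h : IsCenteredGaussian C μ) (hC : C.IsPositive)
    (k : H) : ∫ x, inner ℝ k x ^ 2 ∂μ = inner ℝ (C k) k := by
  have h2 := variance_id_gaussianReal (μ := 0) (v := (inner ℝ (C k) k).toNNReal)
  rw [variance_eq_sub (memLp_id_gaussianReal' 2 (by simp))] at h2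
  have h4 : ∫ x, x ^ 2 ∂(gaussianReal 0 (inner ℝ (C k) k).toNNReal) = inner ℝ (C k) k := by
    rw [Real.coe_toNNReal _ (hC.inner_nonneg_left k)] at h2
    simpa using h2
  rw [← h k, integral_map (by fun_prop) (by fun_prop)] at h4
  exact h4

/-- Exponential moments of a centered Gaussian random variable. -/
theorem integrable_exp_of_map_eq {Ω : Type*} [MeasurableSpace Ω] {P : Measure Ω} {X : Ω → ℝ}
    {v : ℝ≥0} (hX : P.map X = gaussianReal 0 v) :
    Integrable (fun ω => Real.exp (X ω)) P ∧ ∫ ω, Real.exp (X ω) ∂P = Real.exp (v / 2) := by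
  have hm : AEMeasurable X P := AEMeasurable.of_map_ne_zero (by simp [NeZero.ne, hX])
  have h1 : ∫ ω, Real.exp (X ω) ∂P = Real.exp (v / 2) := by
    have := mgf_gaussianReal hX 1
    simpa [mgf] using this
  refine ⟨?_, h1⟩
  -- A non-integrable function has integral 0 by convention, which contradicts the positive value
  -- just computed.
  by_contra hn
  rw [integral_undef hn] at h1
  exact (Real.exp_pos _).ne h1

theorem IsCenteredGaussian.integral_exp (h : IsCenteredGaussian C μ) (hC : C.IsPositive) (k : H) :
    Integrable (fun x => Real.exp (inner ℝ k x)) μ ∧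
      ∫ x, Real.exp (inner ℝ k x) ∂μ = Real.exp (inner ℝ (C k) k / 2) := by
  have := integrable_exp_of_map_eq (h k)
  rwa [Real.coe_toNNReal _ (hC.inner_nonneg_left k)] at this

end Gaussian

/-! ### White noise, Wick exponentials and second quantization -/

section WhiteNoise

theorem norm_linearCombination_eq {ι E F : Type*} [NormedAddCommGroup E] [InnerProductSpace ℝ E]
    [NormedAddCommGroup F] [InnerProductSpace ℝ F] {v : ι → E} {w : ι → F}
    (h : ∀ i j, inner ℝ (v i) (v j) = inner ℝ (w i) (w j)) (c : ι →₀ ℝ) :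
    ‖Finsupp.linearCombination ℝ v c‖ = ‖Finsupp.linearCombination ℝ w c‖ := by
  refine (sq_eq_sq₀ (norm_nonneg _) (norm_nonneg _)).1 ?_
  rw [← real_inner_self_eq_norm_sq, ← real_inner_self_eq_norm_sq]
  simp only [Finsupp.linearCombination_apply, Finsupp.sum, sum_inner, inner_sum, inner_smul_left,
    inner_smul_right, h]

variable {H : Type*} [NormedAddCommGroup H] [InnerProductSpace ℝ H] [CompleteSpace H]
  [MeasurableSpace H] [BorelSpace H] [SecondCountableTopology H]
  {C : H →L[ℝ] H} {μ : Measure H}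

theorem norm_toLp_inner (h : IsCenteredGaussian C μ) (hC : C.IsPositive) (k : H) :
    ‖(h.memLp_inner k).toLp _‖ = ‖sqrtOp C k‖ := by
  obtain ⟨h1, h2⟩ := sqrtOp_spec hC
  refine (sq_eq_sq₀ (norm_nonneg _) (norm_nonneg _)).1 ?_
  rw [norm_sq_eq_inner_of_comp_self h1 h2, ← h.integral_inner_sq hC, ← real_inner_self_eq_norm_sq,
    L2.inner_def]
  refine integral_congr_ae ?_
  filter_upwards [(h.memLp_inner k).coeFn_toLp] with x hx
  rw [hx, real_inner_self_eq_norm_sq, Real.norm_eq_abs, sq_abs]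

/-- Since ⟨k, ·⟩ has L² norm ‖C^{1/2} k‖, the assignment C^{1/2} k ↦ ⟨k, ·⟩ is well defined and
isometric on a dense subspace. -/
theorem whiteNoise_spec (h : IsCenteredGaussian C μ) (hC : C.IsPositive)
    (hinj : Function.Injective C) (k : H) :
    whiteNoise C μ (sqrtOp C k) =ᵐ[μ] fun x => inner ℝ k x := by
  refine described_spec (p := fun W : H →L[ℝ] Lp ℝ 2 μ =>
    ∀ k : H, W (sqrtOp C k) =ᵐ[μ] fun x => inner ℝ k x) ?_ k
  let f : H →ₗ[ℝ] Lp ℝ 2 μ :=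
    { toFun := fun k => (h.memLp_inner k).toLp _
      map_add' := fun x y => by
        rw [← MemLp.toLp_add]
        congr 1
        ext z
        exact inner_add_left x y z
      map_smul' := fun c x => by
        rw [RingHom.id_apply, ← MemLp.toLp_const_smul]
        congr 1
        ext z
        exact real_inner_smul_left x z c }
  have hd : DenseRange (sqrtOp C).toLinearMap := denseRange_sqrtOp hC hinj
  refine ⟨f.extendOfNorm (sqrtOp C).toLinearMap, fun k => ?_⟩
  have := LinearMap.extendOfNorm_eq (f := f) hd ⟨1, fun x => by
    rw [one_mul]
    exact (norm_toLp_inner h hC x).le⟩ k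
  change f.extendOfNorm (sqrtOp C).toLinearMap ((sqrtOp C).toLinearMap k) =ᵐ[μ] _
  rw [this]
  exact (h.memLp_inner k).coeFn_toLp

theorem map_whiteNoise (h : IsCenteredGaussian C μ) (hC : C.IsPositive)
    (hinj : Function.Injective C) (x : H) :
    μ.map (whiteNoise C μ x) = gaussianReal 0 (‖x‖ ^ 2).toNNReal := by
  have := h.isProbabilityMeasure
  obtain ⟨h1, h2⟩ := sqrtOp_spec hC
  obtain ⟨u, hu, hux⟩ := mem_closure_iff_seq_limit.1 (denseRange_sqrtOp hC hinj x)
  choose k hk using hu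
  refine map_eq_gaussianReal_of_tendsto (v := fun n => (‖u n‖ ^ 2).toNNReal)
    (((whiteNoise C μ).continuous.tendsto x).comp hux)
    ((continuous_real_toNNReal.tendsto _).comp (hux.norm.pow 2)) fun n => ?_
  rw [Function.comp_apply, ← hk n, Measure.map_congr (whiteNoise_spec h hC hinj (k n)), h (k n),
    norm_sq_eq_inner_of_comp_self h1 h2]

theorem integral_exp_whiteNoise (h : IsCenteredGaussian C μ) (hC : C.IsPositive)
    (hinj : Function.Injective C) (x : H) :
    Integrable (fun ω => Real.exp (whiteNoise C μ x ω)) μ ∧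
      ∫ ω, Real.exp (whiteNoise C μ x ω) ∂μ = Real.exp (‖x‖ ^ 2 / 2) := by
  have := integrable_exp_of_map_eq (map_whiteNoise h hC hinj x)
  rwa [Real.coe_toNNReal _ (sq_nonneg _)] at this

theorem wickExp_mul_ae (x y : H) : (fun ω => wickExp C μ x ω * wickExp C μ y ω) =ᵐ[μ]
    fun ω => Real.exp (whiteNoise C μ (x + y) ω) * Real.exp (-(‖x‖ ^ 2 + ‖y‖ ^ 2) / 2) := by
  have h1 : whiteNoise C μ (x + y) =ᵐ[μ]
      ⇑(whiteNoise C μ x) + ⇑(whiteNoise C μ y) := by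
    rw [map_add]
    exact Lp.coeFn_add _ _
  filter_upwards [h1] with ω hω
  rw [wickExp, wickExp, hω, Pi.add_apply, ← Real.exp_add, ← Real.exp_add]
  congr 1
  ring

theorem memLp_wickExp (h : IsCenteredGaussian C μ) (hC : C.IsPositive)
    (hinj : Function.Injective C) (x : H) : MemLp (wickExp C μ x) 2 μ := by
  rw [memLp_two_iff_integrable_sq]
  · simp_rw [pow_two]
    exact ((integral_exp_whiteNoise h hC hinj (x + x)).1.mul_const _).congr
      (wickExp_mul_ae x x).symm
  · have := Lp.aestronglyMeasurable (whiteNoise C μ x)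
    exact (by fun_prop : Continuous fun r : ℝ =>
      Real.exp (r - ‖x‖ ^ 2 / 2)).comp_aestronglyMeasurable this

/-- The Wick exponential as an element of `L²`. -/
noncomputable def wickLp (hw : ∀ x, MemLp (wickExp C μ x) 2 μ) (x : H) : Lp ℝ 2 μ :=
  (hw x).toLp _

/-- E(exp φ_{x+y}) = exp(‖x + y‖²/2), and the normalising factors cancel all of the exponent except
⟨x, y⟩. Since only this kernel enters, unitarity, symmetry and continuity can be checked on H. -/
theorem inner_wickLp (h : IsCenteredGaussian C μ) (hC : C.IsPositive)
    (hinj : Function.Injective C) (hw : ∀ x, MemLp (wickExp C μ x) 2 μ) (x y : H) :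
    inner ℝ (wickLp hw x) (wickLp hw y) = Real.exp (inner ℝ x y) := by
  have h1 : (fun ω => inner ℝ (wickLp hw x ω) (wickLp hw y ω)) =ᵐ[μ]
      fun ω => wickExp C μ x ω * wickExp C μ y ω := by
    filter_upwards [(hw x).coeFn_toLp, (hw y).coeFn_toLp] with ω h1 h2
    rw [wickLp, wickLp, h1, h2, mul_comm]
    rfl
  rw [L2.inner_def, integral_congr_ae (h1.trans (wickExp_mul_ae x y)), integral_mul_const,
    (integral_exp_whiteNoise h hC hinj _).2, ← Real.exp_add]
  congr 1
  rw [norm_add_sq_real]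
  ring

theorem wickExp_sqrtOp_ae (h : IsCenteredGaussian C μ) (hC : C.IsPositive)
    (hinj : Function.Injective C) (k : H) : wickExp C μ (sqrtOp C k) =ᵐ[μ]
      fun x => Real.exp (inner ℝ k x - ‖sqrtOp C k‖ ^ 2 / 2) := by
  filter_upwards [whiteNoise_spec h hC hinj k] with x hx
  rw [wickExp, hx]

theorem integral_withDensity_toNNReal {g : H → ℝ} (hg : Measurable g) (e : H → ℝ) :
    ∫ x, e x ∂(μ.withDensity fun x => ((g x).toNNReal : ℝ≥0∞)) =
      ∫ x, (g x).toNNReal * e x ∂μ := by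
  rw [integral_withDensity_eq_integral_smul (by fun_prop)]
  rfl

/-- A function in `L²` which is orthogonal to all exponentials `exp ⟪k, ·⟫` vanishes. -/
theorem eq_zero_of_integral_mul_exp_eq_zero (h : IsCenteredGaussian C μ) (hC : C.IsPositive)
    (f : Lp ℝ 2 μ) (hf : ∀ k : H, ∫ x, f x * Real.exp (inner ℝ k x) ∂μ = 0) : f = 0 := by
  have := h.isProbabilityMeasure
  have hfm : Measurable f := (Lp.stronglyMeasurable f).measurable
  have hfL := Lp.memLp f
  have hexp : ∀ k : H, MemLp (fun x => Real.exp (inner ℝ k x)) 2 μ := fun k => by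
    rw [memLp_two_iff_integrable_sq (by fun_prop)]
    refine (h.integral_exp hC ((2 : ℝ) • k)).1.congr (Eventually.of_forall fun x => ?_)
    change Real.exp (inner ℝ ((2 : ℝ) • k) x) = Real.exp (inner ℝ k x) ^ 2
    rw [← Real.exp_nat_mul, real_inner_smul_left]
    norm_num
  have hpos : MemLp (fun x => ((f x).toNNReal : ℝ)) 2 μ :=
    hfL.of_le (by fun_prop) (Eventually.of_forall fun x => by
      rw [Real.coe_toNNReal', Real.norm_eq_abs, Real.norm_eq_abs, abs_of_nonneg (le_max_right _ _)]
      exact max_le (le_abs_self _) (abs_nonneg _))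
  have hneg : MemLp (fun x => ((-f x).toNNReal : ℝ)) 2 μ :=
    hfL.of_le (by fun_prop) (Eventually.of_forall fun x => by
      rw [Real.coe_toNNReal', Real.norm_eq_abs, Real.norm_eq_abs, abs_of_nonneg (le_max_right _ _)]
      exact max_le (neg_le_abs _) (abs_nonneg _))
  -- The positive and negative parts of f are densities of two finite measures with the same Laplace
  -- transform; their equality means f = 0.
  set ν : Measure H := μ.withDensity fun x => ((f x).toNNReal : ℝ≥0∞)
  set ν' : Measure H := μ.withDensity fun x => ((-f x).toNNReal : ℝ≥0∞)
  have hν : IsFiniteMeasure ν := by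
    have := isFiniteMeasure_withDensity_ofReal (hpos.integrable one_le_two).2
    simpa only [ENNReal.ofReal_coe_nnreal] using this
  have hν' : IsFiniteMeasure ν' := by
    have := isFiniteMeasure_withDensity_ofReal (hneg.integrable one_le_two).2
    simpa only [ENNReal.ofReal_coe_nnreal] using this
  have hint : ∀ k : H, Integrable (fun x => Real.exp (inner ℝ k x)) ν := fun k => by
    rw [integrable_withDensity_iff_integrable_smul (by fun_prop)]
    exact (hpos.integrable_mul (hexp k))
  have heq : ∀ k : H, ∫ x, Real.exp (inner ℝ k x) ∂ν = ∫ x, Real.exp (inner ℝ k x) ∂ν' := by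
    intro k
    rw [integral_withDensity_toNNReal hfm,
      integral_withDensity_toNNReal (g := fun x => -f x) hfm.neg, ← sub_eq_zero]
    refine (integral_sub (hpos.integrable_mul (hexp k))
      (hneg.integrable_mul (hexp k))).symm.trans ?_
    rw [← hf k]
    refine integral_congr_ae (Eventually.of_forall fun x => ?_)
    change ((f x).toNNReal : ℝ) * _ - ((-f x).toNNReal : ℝ) * _ = f x * _
    rw [← sub_mul, Real.coe_toNNReal', Real.coe_toNNReal']
    rcases le_total 0 (f x) with h0 | h0
    · rw [max_eq_left h0, max_eq_right (by linarith), sub_zero]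
    · rw [max_eq_right h0, max_eq_left (by linarith), zero_sub, neg_neg]
  have hmass : ν.real univ = ν'.real univ := by
    have := heq 0
    simpa using this
  have hzero : ν = 0 ↔ ν' = 0 := by
    rw [← Measure.measure_univ_eq_zero, ← Measure.measure_univ_eq_zero,
      ← measureReal_eq_zero_iff, ← measureReal_eq_zero_iff, hmass]
  have hνν : ν = ν' := by
    refine Measure.ext_of_charFun ?_
    ext k
    have hmgf : mgf (fun x => inner ℝ k x) ν = mgf (fun x => inner ℝ k x) ν' := by
      ext t
      have := heq (t • k)
      simp_rw [real_inner_smul_left] at this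
      exact this
    have hset : integrableExpSet (fun x => inner ℝ k x) ν = univ := by
      refine eq_univ_of_forall fun t => ?_
      have := hint (t • k)
      simp_rw [real_inner_smul_left] at this
      exact this
    -- Analytic continuation: exponential moments exist for every real parameter, so equality on the
    -- real axis persists at i, where the transform is the characteristic function.
    have h1 := eqOn_complexMGF_of_mgf' hmgf hzero (x := Complex.I) (by simp [hset])
    simp only [complexMGF] at h1
    rw [charFun_apply, charFun_apply]
    convert h1 using 3 <;> · rw [real_inner_comm, mul_comm]
  rw [withDensity_eq_iff (by fun_prop) (by fun_prop) ?_] at hνν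
  · refine (Lp.eq_zero_iff_ae_eq_zero).2 ?_
    filter_upwards [hνν] with x hx
    have hx' := congrArg NNReal.toReal (ENNReal.coe_injective hx)
    rw [Real.coe_toNNReal', Real.coe_toNNReal'] at hx'
    rcases le_total 0 (f x) with h0 | h0
    · rw [max_eq_left h0, max_eq_right (by linarith)] at hx'
      exact hx'
    · rw [max_eq_right h0, max_eq_left (by linarith)] at hx'
      simp only [Pi.zero_apply]
      linarith
  · have := hν.measure_univ_lt_top
    rw [withDensity_apply _ MeasurableSet.univ, Measure.restrict_univ] at this
    exact this.ne

theorem denseRange_linearCombination_wickLp (h : IsCenteredGaussian C μ) (hC : C.IsPositive)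
    (hinj : Function.Injective C) (hw : ∀ x, MemLp (wickExp C μ x) 2 μ) :
    DenseRange (Finsupp.linearCombination ℝ (wickLp hw)) := by
  have h1 : Dense (LinearMap.range (Finsupp.linearCombination ℝ (wickLp hw)) :
      Set (Lp ℝ 2 μ)) := by
    rw [Submodule.dense_iff_topologicalClosure_eq_top, Submodule.topologicalClosure_eq_top_iff,
      Submodule.eq_bot_iff]
    intro f hf
    refine eq_zero_of_integral_mul_exp_eq_zero h hC f fun k => ?_
    have h2 := (Submodule.mem_orthogonal _ _).1 hf (wickLp hw (sqrtOp C k))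
      ⟨Finsupp.single (sqrtOp C k) 1, by simp⟩
    rw [L2.inner_def] at h2
    have h3 : (fun x => inner ℝ (wickLp hw (sqrtOp C k) x) (f x)) =ᵐ[μ]
        fun x => f x * Real.exp (inner ℝ k x) * Real.exp (-‖sqrtOp C k‖ ^ 2 / 2) := by
      filter_upwards [(hw (sqrtOp C k)).coeFn_toLp, wickExp_sqrtOp_ae h hC hinj k] with x h4 h5
      rw [wickLp, h4, h5, mul_assoc, ← Real.exp_add]
      change f x * Real.exp (inner ℝ k x - ‖sqrtOp C k‖ ^ 2 / 2) = _
      congr 2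
      ring
    rw [integral_congr_ae h3, integral_mul_const] at h2
    exact (mul_eq_zero.1 h2).resolve_right (Real.exp_pos _).ne'
  rwa [LinearMap.coe_range] at h1

/-- The second quantization is determined by its values on the Wick exponentials. -/
theorem secondQuantization_eq (h : IsCenteredGaussian C μ) (hC : C.IsPositive)
    (hinj : Function.Injective C) (hw : ∀ x, MemLp (wickExp C μ x) 2 μ) {T : H →L[ℝ] H}
    {G : Lp ℝ 2 μ →L[ℝ] Lp ℝ 2 μ} (hG : ∀ x, G (wickLp hw x) = wickLp hw (T x)) :
    secondQuantization C μ T = G := by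
  have hs := described_spec (p := fun G : Lp ℝ 2 μ →L[ℝ] Lp ℝ 2 μ =>
    ∀ h : H, ∃ hh : MemLp (wickExp C μ h) 2 μ,
      G (hh.toLp (wickExp C μ h)) =ᵐ[μ] wickExp C μ (T h)) ⟨G, fun x => ⟨hw x, by
        have := hG x
        rw [wickLp] at this
        rw [this]
        exact (hw (T x)).coeFn_toLp⟩⟩
  have hs' : ∀ x, secondQuantization C μ T (wickLp hw x) = wickLp hw (T x) := fun x => by
    obtain ⟨hh, hx⟩ := hs x
    exact Lp.ext (hx.trans (hw (T x)).coeFn_toLp.symm)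
  ext1 f
  refine (denseRange_linearCombination_wickLp h hC hinj hw).induction
    (P := fun f => secondQuantization C μ T f = G f) ?_ ?_ f
  · rintro _ ⟨c, rfl⟩
    simp only [Finsupp.linearCombination_apply, Finsupp.sum, map_sum, map_smul, hs', hG]
  · exact isClosed_eq (by fun_prop) (by fun_prop)

/-- The second quantization of a unitary operator is unitary. -/
theorem exists_unitary_secondQuantization (h : IsCenteredGaussian C μ) (hC : C.IsPositive)
    (hinj : Function.Injective C) (hw : ∀ x, MemLp (wickExp C μ x) 2 μ) (U : H ≃ₗᵢ[ℝ] H) :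
    ∃ 𝒰 : Lp ℝ 2 μ ≃ₗᵢ[ℝ] Lp ℝ 2 μ, ∀ x, 𝒰 (wickLp hw x) = wickLp hw (U x) := by
  have hd := denseRange_linearCombination_wickLp h hC hinj hw
  obtain ⟨𝒰, h𝒰⟩ := exists_linearIsometryEquiv (Finsupp.linearCombination ℝ (wickLp hw))
    (Finsupp.linearCombination ℝ fun x => wickLp hw (U x)) hd
    -- As U is onto, the exponentials E(U x) are all the exponentials; reindexing by U⁻¹ shows that
    -- no span is lost.
    (hd.mono (by
      rintro _ ⟨c, rfl⟩
      refine ⟨c.mapDomain U.symm, ?_⟩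
      rw [Finsupp.linearCombination_mapDomain]
      congr 2
      ext1 x
      simp))
    (norm_linearCombination_eq fun x y => by
      rw [inner_wickLp h hC hinj, inner_wickLp h hC hinj, U.inner_map_map])
  refine ⟨𝒰, fun x => ?_⟩
  simpa using h𝒰 (Finsupp.single x 1)

end WhiteNoise

/-! ### The Ornstein-Uhlenbeck semigroup on L² and the meaning of its symmetry -/

section Transition

theorem exists_bounded_of_simpleFunc {Ω : Type*} [MeasurableSpace Ω] {P : Measure Ω}
    (f : Lp.simpleFunc ℝ 2 P) : ∃ g : Ω → ℝ, Measurable g ∧ (∃ c : ℝ, ∀ x, |g x| ≤ c) ∧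
      (f : Lp ℝ 2 P) =ᵐ[P] g := by
  obtain ⟨c, hc⟩ := (Lp.simpleFunc.toSimpleFunc f).exists_forall_norm_le
  exact ⟨Lp.simpleFunc.toSimpleFunc f, (Lp.simpleFunc.toSimpleFunc f).measurable, ⟨c, hc⟩,
    (Lp.simpleFunc.toSimpleFunc_eq_toFun f).symm⟩

variable {H : Type*} [NormedAddCommGroup H] [InnerProductSpace ℝ H] [CompleteSpace H]
  [MeasurableSpace H] [BorelSpace H] [SecondCountableTopology H]
  {S : ℝ → H →L[ℝ] H} {Q : H →L[ℝ] H}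

theorem isCenteredGaussian_invMeasure (hS : IsC0Semigroup S) (hQ : Q.IsPositive)
    (htr : HasFiniteTrace S Q) : IsCenteredGaussian (covOp S Q ⊤) (invMeasure S Q) :=
  isCenteredGaussian_centeredGaussian (isPositive_covOp hS hQ htr ⊤)
    (opTrace_covOp_lt_top hS hQ htr ⊤)

theorem isCenteredGaussian_covOp (hS : IsC0Semigroup S) (hQ : Q.IsPositive)
    (htr : HasFiniteTrace S Q) (t : ℝ) :
    IsCenteredGaussian (covOp S Q t) (centeredGaussian (covOp S Q t)) :=
  isCenteredGaussian_centeredGaussian (isPositive_covOp hS hQ htr t)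
    (opTrace_covOp_lt_top hS hQ htr t)

theorem transition_apply {φ : H → ℝ} (hφ : Measurable φ) (t : ℝ) (x : H) :
    transition S Q t φ x = ∫ y, φ (S t x + y) ∂(centeredGaussian (covOp S Q t)) := by
  rw [transition, ouLaw, integral_map (by fun_prop) hφ.aestronglyMeasurable]

/-- The measure `N(0, Q_∞)` is invariant for the Ornstein-Uhlenbeck semigroup. -/
theorem measurePreserving_step (hS : IsC0Semigroup S) (hQ : Q.IsPositive)
    (htr : HasFiniteTrace S Q) {t : ℝ} (ht : 0 ≤ t) :
    MeasurePreserving (fun p : H × H => S t p.1 + p.2)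
      ((invMeasure S Q).prod (centeredGaussian (covOp S Q t))) (invMeasure S Q) := by
  have hμ := isCenteredGaussian_invMeasure hS hQ htr
  have hν := isCenteredGaussian_covOp hS hQ htr t
  have := hμ.isProbabilityMeasure
  have := hν.isProbabilityMeasure
  have hm : Measurable (fun p : H × H => S t p.1 + p.2) := by fun_prop
  refine ⟨hm, ?_⟩
  have := Measure.isProbabilityMeasure_map
    (μ := (invMeasure S Q).prod (centeredGaussian (covOp S Q t))) hm.aemeasurable
  refine Measure.ext_of_charFun ?_
  ext k
  have hc : Continuous fun x : H => Complex.exp ((inner ℝ x k : ℝ) * Complex.I) := by fun_prop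
  rw [charFun_apply, charFun_apply, integral_map hm.aemeasurable hc.aestronglyMeasurable]
  have h1 : ∀ p : H × H, Complex.exp ((inner ℝ (S t p.1 + p.2) k : ℝ) * Complex.I) =
      Complex.exp ((inner ℝ ((S t).adjoint k) p.1 : ℝ) * Complex.I) *
        Complex.exp ((inner ℝ k p.2 : ℝ) * Complex.I) := fun p => by
    rw [← Complex.exp_add, inner_add_left, ContinuousLinearMap.adjoint_inner_left,
      real_inner_comm k (S t p.1), real_inner_comm k p.2]
    push_cast
    ring_nf
  simp_rw [h1]
  rw [integral_prod_mul (fun x => Complex.exp ((inner ℝ ((S t).adjoint k) x : ℝ) * Complex.I))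
    (fun y => Complex.exp ((inner ℝ k y : ℝ) * Complex.I)),
    hμ.integral_cexp (isPositive_covOp hS hQ htr ⊤),
    hν.integral_cexp (isPositive_covOp hS hQ htr t)]
  have h2 : ∫ x, Complex.exp ((inner ℝ x k : ℝ) * Complex.I) ∂(invMeasure S Q) =
      Complex.exp (-(inner ℝ (covOp S Q ⊤ k) k : ℝ) / 2) := by
    refine (integral_congr_ae (Eventually.of_forall fun x => ?_)).trans
      (hμ.integral_cexp (isPositive_covOp hS hQ htr ⊤) k)
    simp only [real_inner_comm k x]
  rw [h2, inner_covOp_top_eq_add hS hQ htr ht k, ← Complex.exp_add]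
  push_cast
  ring_nf

/-- The action of `R_t` on `L²(H, μ)`. -/
theorem exists_transition_operator (hS : IsC0Semigroup S) (hQ : Q.IsPositive)
    (htr : HasFiniteTrace S Q) {t : ℝ} (ht : 0 ≤ t) :
    ∃ T : Lp ℝ 2 (invMeasure S Q) →L[ℝ] Lp ℝ 2 (invMeasure S Q), ∀ φ : H → ℝ, Measurable φ →
      ∀ hφ : MemLp φ 2 (invMeasure S Q), T (hφ.toLp φ) =ᵐ[invMeasure S Q] transition S Q t φ := by
  have hμ := isCenteredGaussian_invMeasure hS hQ htr
  have hν := isCenteredGaussian_covOp hS hQ htr t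
  have := hμ.isProbabilityMeasure
  have := hν.isProbabilityMeasure
  have hp1 : MeasurePreserving Prod.fst
    ((invMeasure S Q).prod (centeredGaussian (covOp S Q t))) (invMeasure S Q) :=
    measurePreserving_fst
  have hp2 := measurePreserving_step hS hQ htr ht
  -- R_t = J1* J2, where (J1 f)(x, y) = f(x) and (J2 f)(x, y) = f(S(t) x + y). Both are isometries
  -- into L²(μ ⊗ N(0, Q_t)), the second by invariance of μ; J1* integrates y out. The formula is
  -- verified against indicators of sets.
  set J1 := (Lp.compMeasurePreservingₗᵢ ℝ (E := ℝ) (p := 2) _ hp1).toContinuousLinearMap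
  set J2 := (Lp.compMeasurePreservingₗᵢ ℝ (E := ℝ) (p := 2) _ hp2).toContinuousLinearMap
  refine ⟨J1.adjoint.comp J2, fun φ hφm hφ => ?_⟩
  have hcomp : MemLp (fun p : H × H => φ (S t p.1 + p.2)) 2
    ((invMeasure S Q).prod (centeredGaussian (covOp S Q t))) := hφ.comp_measurePreserving hp2
  have hcint := hcomp.integrable one_le_two
  have htrans : transition S Q t φ =
      fun x => ∫ y, φ (S t x + y) ∂(centeredGaussian (covOp S Q t)) :=
    funext fun x => transition_apply hφm t x
  have hRint : Integrable (transition S Q t φ) (invMeasure S Q) := by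
    rw [htrans]
    exact hcint.integral_prod_left
  refine Integrable.ae_eq_of_forall_setIntegral_eq _ _
    ((Lp.memLp _).integrable one_le_two) hRint fun A hA hAμ => ?_
  have hind := indicatorConstLp_coeFn (p := 2) (hs := hA) (hμs := hAμ.ne) (c := (1 : ℝ))
  have e1 := L2.inner_indicatorConstLp_one (𝕜 := ℝ) hA hAμ.ne ((J1.adjoint.comp J2) (hφ.toLp φ))
  rw [← e1, ContinuousLinearMap.comp_apply, ContinuousLinearMap.adjoint_inner_right, L2.inner_def]
  have h1 : J1 (indicatorConstLp 2 hA hAμ.ne 1) =ᵐ[(invMeasure S Q).prod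
      (centeredGaussian (covOp S Q t))] fun p => A.indicator (fun _ => (1 : ℝ)) p.1 :=
    (Lp.coeFn_compMeasurePreserving _ hp1).trans (hp1.quasiMeasurePreserving.ae_eq_comp hind)
  have h2 : J2 (hφ.toLp φ) =ᵐ[(invMeasure S Q).prod
      (centeredGaussian (covOp S Q t))] fun p => φ (S t p.1 + p.2) :=
    (Lp.coeFn_compMeasurePreserving _ hp2).trans
      (hp2.quasiMeasurePreserving.ae_eq_comp hφ.coeFn_toLp)
  have h3 : (fun p => inner ℝ (J1 (indicatorConstLp 2 hA hAμ.ne 1) p) (J2 (hφ.toLp φ) p))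
      =ᵐ[(invMeasure S Q).prod (centeredGaussian (covOp S Q t))]
      (Prod.fst ⁻¹' A).indicator fun p => φ (S t p.1 + p.2) := by
    filter_upwards [h1, h2] with p hp1 hp2
    rw [hp1, hp2]
    by_cases hpA : p.1 ∈ A
    · rw [indicator_of_mem hpA, indicator_of_mem (show p ∈ Prod.fst ⁻¹' A from hpA)]
      exact mul_one _
    · rw [indicator_of_notMem hpA, indicator_of_notMem (show p ∉ Prod.fst ⁻¹' A from hpA)]
      exact mul_zero _
  rw [integral_congr_ae h3, integral_prod _ (hcint.indicator (measurable_fst hA)),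
    ← integral_indicator hA]
  refine integral_congr_ae (Eventually.of_forall fun x => ?_)
  simp only [htrans]
  by_cases hxA : x ∈ A
  · simp only [indicator_of_mem hxA]
    refine integral_congr_ae (Eventually.of_forall fun y => ?_)
    exact indicator_of_mem (show (x, y) ∈ Prod.fst ⁻¹' A from hxA) _
  · simp only [indicator_of_notMem hxA]
    refine integral_eq_zero_of_ae (Eventually.of_forall fun y => ?_)
    exact indicator_of_notMem (show (x, y) ∉ Prod.fst ⁻¹' A from hxA) _

/-- Bounded functions determine the operator, because simple functions are dense. The formula is
needed for all Borel functions in L², since exponentials are unbounded. -/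
theorem ouOperator_ae (hS : IsC0Semigroup S) (hQ : Q.IsPositive)
    (htr : HasFiniteTrace S Q) {t : ℝ} (ht : 0 ≤ t) {φ : H → ℝ} (hφm : Measurable φ)
    (hφ : MemLp φ 2 (invMeasure S Q)) :
    ouOperator S Q t (hφ.toLp φ) =ᵐ[invMeasure S Q] transition S Q t φ := by
  have := (isCenteredGaussian_invMeasure hS hQ htr).isProbabilityMeasure
  obtain ⟨T, hT⟩ := exists_transition_operator hS hQ htr ht
  have hs := described_spec (p := fun T : Lp ℝ 2 (invMeasure S Q) →L[ℝ] Lp ℝ 2 (invMeasure S Q) =>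
    ∀ φ : H → ℝ, Measurable φ → (∃ c : ℝ, ∀ x, |φ x| ≤ c) →
      ∃ hφ : MemLp φ 2 (invMeasure S Q), T (hφ.toLp φ) =ᵐ[invMeasure S Q] transition S Q t φ)
    ⟨T, fun φ hφm ⟨c, hc⟩ =>
      have hL : MemLp φ 2 (invMeasure S Q) :=
        MemLp.of_bound hφm.aestronglyMeasurable c (Eventually.of_forall hc)
      ⟨hL, hT φ hφm hL⟩⟩
  have heq : ouOperator S Q t = T := by
    ext1 f
    refine (Lp.simpleFunc.denseRange (μ := invMeasure S Q) (E := ℝ) (p := 2) (by simp)).induction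
      (P := fun f => ouOperator S Q t f = T f) ?_ (isClosed_eq (by fun_prop) (by fun_prop)) f
    rintro _ ⟨f, rfl⟩
    obtain ⟨g, hgm, hgb, hfg⟩ := exists_bounded_of_simpleFunc f
    obtain ⟨hgL, hg⟩ := hs g hgm hgb
    have e : (f : Lp ℝ 2 (invMeasure S Q)) = hgL.toLp g :=
      Lp.ext (hfg.trans hgL.coeFn_toLp.symm)
    rw [e]
    exact Lp.ext (hg.trans (hT g hgm hgL).symm)
  rw [heq]
  exact hT φ hφm hφ

/-- Integrating exp ⟨k, S(t) x + y⟩ over y produces the factor exp(⟨Q_t k, k⟩/2). By Q_∞ = Q_t +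
S(t) Q_∞ S(t)*, this is exactly the change of normalisation from ‖A k‖² to ‖A S(t)* k‖². -/
theorem ouOperator_wickLp (hS : IsC0Semigroup S) (hQ : Q.IsPositive) (htr : HasFiniteTrace S Q)
    (hinj : Function.Injective (covOp S Q ⊤))
    (hw : ∀ x, MemLp (wickExp (covOp S Q ⊤) (invMeasure S Q) x) 2 (invMeasure S Q))
    {t : ℝ} (ht : 0 ≤ t) (k : H) :
    ouOperator S Q t (wickLp hw (sqrtOp (covOp S Q ⊤) k)) =
      wickLp hw (sqrtOp (covOp S Q ⊤) ((S t).adjoint k)) := by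
  have hμ := isCenteredGaussian_invMeasure hS hQ htr
  have hν := isCenteredGaussian_covOp hS hQ htr t
  have hC := isPositive_covOp hS hQ htr ⊤
  obtain ⟨h1, h2⟩ := sqrtOp_spec hC
  set A := sqrtOp (covOp S Q ⊤)
  have ha := wickExp_sqrtOp_ae hμ hC hinj k
  have hg : MemLp (fun x => Real.exp (inner ℝ k x - ‖A k‖ ^ 2 / 2)) 2 (invMeasure S Q) :=
    (memLp_congr_ae ha).1 (hw (A k))
  have e : wickLp hw (A k) = hg.toLp _ :=
    Lp.ext ((hw (A k)).coeFn_toLp.trans (ha.trans hg.coeFn_toLp.symm))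
  rw [e]
  refine Lp.ext ((ouOperator_ae hS hQ htr ht (by fun_prop) hg).trans ?_)
  refine EventuallyEq.trans ?_ (hw (A ((S t).adjoint k))).coeFn_toLp.symm
  refine EventuallyEq.trans (Eventually.of_forall fun x => ?_)
    (wickExp_sqrtOp_ae hμ hC hinj ((S t).adjoint k)).symm
  rw [transition_apply (by fun_prop)]
  have h3 : ∀ y, Real.exp (inner ℝ k (S t x + y) - ‖A k‖ ^ 2 / 2) =
      Real.exp (inner ℝ ((S t).adjoint k) x - ‖A k‖ ^ 2 / 2) * Real.exp (inner ℝ k y) := fun y => by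
    rw [← Real.exp_add, inner_add_right, ContinuousLinearMap.adjoint_inner_left]
    ring_nf
  simp_rw [h3]
  rw [integral_const_mul, (hν.integral_exp (isPositive_covOp hS hQ htr t) k).2, ← Real.exp_add,
    norm_sq_eq_inner_of_comp_self h1 h2, norm_sq_eq_inner_of_comp_self h1 h2,
    inner_covOp_top_eq_add hS hQ htr ht]
  congr 1
  ring

theorem inner_ouOperator (hS : IsC0Semigroup S) (hQ : Q.IsPositive) (htr : HasFiniteTrace S Q)
    (hsymm : IsSymmetricOU S Q) {t : ℝ} (ht : 0 ≤ t) (f g : Lp ℝ 2 (invMeasure S Q)) :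
    inner ℝ (ouOperator S Q t f) g = inner ℝ f (ouOperator S Q t g) := by
  have := (isCenteredGaussian_invMeasure hS hQ htr).isProbabilityMeasure
  refine (Lp.simpleFunc.denseRange (μ := invMeasure S Q) (E := ℝ) (p := 2)
    (by simp)).induction_on₂ (p := fun f g =>
      inner ℝ (ouOperator S Q t f) g = inner ℝ f (ouOperator S Q t g))
    (isClosed_eq (by fun_prop) (by fun_prop)) (fun f g => ?_) f g
  obtain ⟨φ, hφm, hφb, hφ⟩ := exists_bounded_of_simpleFunc f
  obtain ⟨ψ, hψm, hψb, hψ⟩ := exists_bounded_of_simpleFunc g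
  have hφL : MemLp φ 2 (invMeasure S Q) := (memLp_congr_ae hφ).1 (Lp.memLp _)
  have hψL : MemLp ψ 2 (invMeasure S Q) := (memLp_congr_ae hψ).1 (Lp.memLp _)
  have e1 : (f : Lp ℝ 2 (invMeasure S Q)) = hφL.toLp φ := Lp.ext (hφ.trans hφL.coeFn_toLp.symm)
  have e2 : (g : Lp ℝ 2 (invMeasure S Q)) = hψL.toLp ψ := Lp.ext (hψ.trans hψL.coeFn_toLp.symm)
  rw [e1, e2, L2.inner_def, L2.inner_def]
  have h1 := ouOperator_ae hS hQ htr ht hφm hφL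
  have h2 := ouOperator_ae hS hQ htr ht hψm hψL
  refine Eq.trans (integral_congr_ae ?_)
    ((hsymm t ht φ ψ hφm hψm hφb hψb).trans (integral_congr_ae ?_))
  · filter_upwards [h1, hψL.coeFn_toLp] with x h3 h4
    rw [h3, h4]
    rfl
  · filter_upwards [h2, hφL.coeFn_toLp] with x h3 h4
    rw [h3, h4]
    exact mul_comm _ _

/-- Symmetry of the Ornstein-Uhlenbeck semigroup implies `S(t) Q_∞ = Q_∞ S(t)*`. -/
theorem comp_covOp_of_symmetric (hS : IsC0Semigroup S) (hQ : Q.IsPositive)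
    (htr : HasFiniteTrace S Q) (hinj : Function.Injective (covOp S Q ⊤))
    (hsymm : IsSymmetricOU S Q) {t : ℝ} (ht : 0 ≤ t) (x : H) :
    S t (covOp S Q ⊤ x) = covOp S Q ⊤ ((S t).adjoint x) := by
  have hμ := isCenteredGaussian_invMeasure hS hQ htr
  have hC := isPositive_covOp hS hQ htr ⊤
  have hw := memLp_wickExp hμ hC hinj
  obtain ⟨h1, h2⟩ := sqrtOp_spec hC
  refine ext_inner_right ℝ fun y => ?_
  -- On Wick exponentials symmetry reads exp ⟨A S(t)* x, A y⟩ = exp ⟨A x, A S(t)* y⟩; taking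
  -- logarithms gives the operator identity.
  have h3 := inner_ouOperator hS hQ htr hsymm ht (wickLp hw (sqrtOp (covOp S Q ⊤) x))
    (wickLp hw (sqrtOp (covOp S Q ⊤) y))
  rw [ouOperator_wickLp hS hQ htr hinj hw ht, ouOperator_wickLp hS hQ htr hinj hw ht,
    inner_wickLp hμ hC hinj, inner_wickLp hμ hC hinj] at h3
  have h4 := Real.exp_injective h3
  rw [← h1.inner_left_eq_inner_right, ← h1.inner_left_eq_inner_right] at h4
  have h5 : ∀ z, sqrtOp (covOp S Q ⊤) (sqrtOp (covOp S Q ⊤) z) = covOp S Q ⊤ z :=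
    fun z => DFunLike.congr_fun h2 z
  rw [h5, h5, ContinuousLinearMap.adjoint_inner_right] at h4
  exact h4.symm

end Transition

/-! ### Operators symmetric for a second norm -/

section Symmetrizable

variable {H : Type*} [NormedAddCommGroup H] [InnerProductSpace ℝ H] [CompleteSpace H]

/-- An operator which is symmetric and contractive for the norm `‖A ·‖` induces a selfadjoint
contraction. -/
theorem exists_selfAdjoint_contraction {A K : H →L[ℝ] H} (hd : DenseRange A)
    (hle : ∀ x, ‖A (K x)‖ ≤ ‖A x‖)
    (hsymm : ∀ x y, inner ℝ (A (K x)) (A y) = inner ℝ (A x) (A (K y))) :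
    ∃ T : H →L[ℝ] H, IsSelfAdjoint T ∧ (∀ x, ‖T x‖ ≤ ‖x‖) ∧ ∀ x, T (A x) = A (K x) := by
  have hb : ∀ x, ‖(A.comp K).toLinearMap x‖ ≤ 1 * ‖A.toLinearMap x‖ := fun x => by
    rw [one_mul]
    exact hle x
  have hd' : DenseRange A.toLinearMap := hd
  have hT : ∀ x, (A.comp K).toLinearMap.extendOfNorm A.toLinearMap (A x) = A (K x) :=
    fun x => LinearMap.extendOfNorm_eq hd' ⟨1, hb⟩ x
  refine ⟨(A.comp K).toLinearMap.extendOfNorm A.toLinearMap, ?_, fun x => ?_, hT⟩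
  · rw [ContinuousLinearMap.isSelfAdjoint_iff_isSymmetric]
    intro x y
    refine hd.induction_on₂ (p := fun x y =>
      inner ℝ ((A.comp K).toLinearMap.extendOfNorm A.toLinearMap x) y =
        inner ℝ x ((A.comp K).toLinearMap.extendOfNorm A.toLinearMap y))
      (isClosed_eq (by fun_prop) (by fun_prop)) (fun x y => ?_) x y
    rw [hT, hT, hsymm]
  · simpa using LinearMap.norm_extendOfNorm_apply_le hd' 1 hb x

/-- The defect form of a selfadjoint contraction decreases along a commuting contraction. -/
theorem defect_le {T R : H →L[ℝ] H} (hT : IsSelfAdjoint T) (hT1 : ∀ x, ‖T x‖ ≤ ‖x‖)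
    (hR1 : ∀ x, ‖R x‖ ≤ ‖x‖) (hc : ∀ x, T (R x) = R (T x)) (z : H) :
    ‖R z‖ ^ 2 - ‖T (R z)‖ ^ 2 ≤ ‖z‖ ^ 2 - ‖T z‖ ^ 2 := by
  have hin : ∀ x, inner ℝ ((1 - T * T) x) x = ‖x‖ ^ 2 - ‖T x‖ ^ 2 := fun x => by
    rw [_root_.sub_apply, inner_sub_left, one_apply_eq_self, real_inner_self_eq_norm_sq,
      mul_apply_eq_comp]
    nth_rewrite 1 [← hT.adjoint_eq]
    rw [ContinuousLinearMap.adjoint_inner_left, real_inner_self_eq_norm_sq]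
  have hp : (1 - T * T).IsPositive := by
    rw [ContinuousLinearMap.isPositive_iff']
    refine ⟨(IsSelfAdjoint.one _).sub ?_, fun x => ?_⟩
    · have := hT.pow 2
      rwa [pow_two] at this
    · rw [hin]
      exact sub_nonneg.2 (pow_le_pow_left₀ (norm_nonneg _) (hT1 x) 2)
  -- F = (1 - T²)^{1/2} commutes with R, and the defect form is ‖F z‖², so ‖F R z‖ = ‖R F z‖ ≤ ‖F
  -- z‖.
  obtain ⟨F, hF, hF2, hFc⟩ := exists_sqrt hp
  have hcTR : Commute T R := ContinuousLinearMap.ext hc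
  have hcF : ∀ x, F (R x) = R (F x) := fun x =>
    DFunLike.congr_fun (hFc R ((Commute.one_left R).sub_left (hcTR.mul_left hcTR))).eq x
  rw [← hin, ← hin, ← norm_sq_eq_inner_of_comp_self hF hF2, ← norm_sq_eq_inner_of_comp_self hF hF2,
    hcF]
  exact pow_le_pow_left₀ (norm_nonneg _) (hR1 _) 2

end Symmetrizable

/-! ### Consequences of symmetry and the polar decomposition of V -/

section Main

variable {H : Type*} [NormedAddCommGroup H] [InnerProductSpace ℝ H] [CompleteSpace H]
  {S : ℝ → H →L[ℝ] H} {Q : H →L[ℝ] H}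

theorem IsC0Semigroup.adjoint_add (hS : IsC0Semigroup S) {s t : ℝ} (hs : 0 ≤ s) (ht : 0 ≤ t)
    (x : H) : (S (s + t)).adjoint x = (S s).adjoint ((S t).adjoint x) := by
  rw [add_comm, hS.map_add t s ht hs, ContinuousLinearMap.adjoint_comp]
  rfl

theorem IsC0Semigroup.adjoint_comm (hS : IsC0Semigroup S) {s t : ℝ} (hs : 0 ≤ s) (ht : 0 ≤ t)
    (x : H) : (S s).adjoint ((S t).adjoint x) = (S t).adjoint ((S s).adjoint x) := by
  rw [← hS.adjoint_add hs ht, ← hS.adjoint_add ht hs, add_comm]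

theorem IsC0Semigroup.adjoint_zero (hS : IsC0Semigroup S) (x : H) : (S 0).adjoint x = x := by
  rw [hS.map_zero]
  refine ext_inner_right ℝ fun y => ?_
  rw [ContinuousLinearMap.adjoint_inner_left]
  rfl

theorem tendsto_covOp_div (hS : IsC0Semigroup S) (hQ : Q.IsPositive)
    (htr : HasFiniteTrace S Q) (x : H) :
    Tendsto (fun t : ℝ => t⁻¹ • covOp S Q t x) (𝓝[>] 0) (𝓝 (Q x)) := by
  have h := tendsto_inv_smul_integral (hS.continuousOn_cov Q x)
  rw [hS.adjoint_zero, hS.map_zero] at h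
  refine h.congr' ?_
  filter_upwards [self_mem_nhdsWithin] with t ht
  rw [covOp_coe_apply hS hQ htr, intervalIntegral.integral_of_le (le_of_lt ht)]

theorem tendsto_inner_covOp (hS : IsC0Semigroup S) (hQ : Q.IsPositive)
    (htr : HasFiniteTrace S Q) (x : H) :
    Tendsto (fun t : ℝ => inner ℝ (covOp S Q t x) x) atTop (𝓝 (inner ℝ (covOp S Q ⊤ x) x)) := by
  have h := intervalIntegral_tendsto_integral_Ioi 0 (integrableOn_cov hS hQ htr x) tendsto_id
  rw [← covOp_top_apply hS hQ htr] at h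
  refine (h.inner tendsto_const_nhds).congr' ?_
  filter_upwards [eventually_ge_atTop 0] with t ht
  rw [covOp_coe_apply hS hQ htr, intervalIntegral.integral_of_le (by exact ht)]
  rfl

theorem covOp_eq_sub (hS : IsC0Semigroup S) (hQ : Q.IsPositive) (htr : HasFiniteTrace S Q)
    (hSC : ∀ t : ℝ, 0 ≤ t → ∀ x, S t (covOp S Q ⊤ x) = covOp S Q ⊤ ((S t).adjoint x))
    {t : ℝ} (ht : 0 ≤ t) (x : H) :
    covOp S Q t x = covOp S Q ⊤ x - covOp S Q ⊤ ((S t).adjoint ((S t).adjoint x)) := by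
  rw [← hSC t ht, eq_sub_iff_add_eq, ← covOp_top_eq_add hS hQ htr ht]

/-- `S(t) Q = Q S(t)*` follows from `S(t) Q_∞ = Q_∞ S(t)*`. -/
theorem comp_eq_comp_adjoint (hS : IsC0Semigroup S) (hQ : Q.IsPositive) (htr : HasFiniteTrace S Q)
    (hSC : ∀ t : ℝ, 0 ≤ t → ∀ x, S t (covOp S Q ⊤ x) = covOp S Q ⊤ ((S t).adjoint x))
    {t : ℝ} (ht : 0 ≤ t) (x : H) : S t (Q x) = Q ((S t).adjoint x) := by
  have h1 := ((S t).continuous.tendsto _).comp (tendsto_covOp_div hS hQ htr x)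
  refine tendsto_nhds_unique h1 ((tendsto_covOp_div hS hQ htr ((S t).adjoint x)).congr' ?_)
  -- Q_s = C - C (S(s)*)², and S(t) passes C as S(t)*, which commutes with S(s)*; so each quotient
  -- s⁻¹ Q_s already has the property.
  filter_upwards [self_mem_nhdsWithin] with s (hs : 0 < s)
  rw [Function.comp_apply, map_smul, covOp_eq_sub hS hQ htr hSC hs.le,
    covOp_eq_sub hS hQ htr hSC hs.le, map_sub, hSC t ht, hSC t ht, hS.adjoint_comm hs.le ht,
    hS.adjoint_comm hs.le ht]

/-- Under the intertwining S(s) Q S(s)* = S(s)² Q, so the kernel of Q lies in that of Q_∞. -/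
theorem injective_of_covOp (hS : IsC0Semigroup S) (hQ : Q.IsPositive) (htr : HasFiniteTrace S Q)
    (hinj : Function.Injective (covOp S Q ⊤))
    (hSQ : ∀ t : ℝ, 0 ≤ t → ∀ x, S t (Q x) = Q ((S t).adjoint x)) : Function.Injective Q := by
  rw [injective_iff_map_eq_zero]
  intro x hx
  refine hinj ?_
  rw [map_zero, covOp_top_apply hS hQ htr]
  refine setIntegral_eq_zero_of_forall_eq_zero fun s (hs : 0 < s) => ?_
  rw [← hSQ s hs.le, hx, map_zero, map_zero]

/-- `Q_∞^{-1/2} S(t) Q_∞^{1/2}` is a selfadjoint contraction. -/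
theorem exists_conj_covOp (hS : IsC0Semigroup S) (hQ : Q.IsPositive) (htr : HasFiniteTrace S Q)
    (hinj : Function.Injective (covOp S Q ⊤))
    (hSC : ∀ t : ℝ, 0 ≤ t → ∀ x, S t (covOp S Q ⊤ x) = covOp S Q ⊤ ((S t).adjoint x))
    {t : ℝ} (ht : 0 ≤ t) : ∃ T : H →L[ℝ] H, IsSelfAdjoint T ∧ (∀ x, ‖T x‖ ≤ ‖x‖) ∧
      ∀ x, T (sqrtOp (covOp S Q ⊤) x) = sqrtOp (covOp S Q ⊤) ((S t).adjoint x) := by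
  have hC := isPositive_covOp hS hQ htr ⊤
  obtain ⟨h1, h2⟩ := sqrtOp_spec hC
  have h3 : ∀ z, sqrtOp (covOp S Q ⊤) (sqrtOp (covOp S Q ⊤) z) = covOp S Q ⊤ z :=
    fun z => DFunLike.congr_fun h2 z
  refine exists_selfAdjoint_contraction (denseRange_sqrtOp hC hinj) (fun x => ?_) fun x y => ?_
  · refine abs_le_of_sq_le_sq' ?_ (norm_nonneg _) |>.2
    rw [norm_sq_eq_inner_of_comp_self h1 h2, norm_sq_eq_inner_of_comp_self h1 h2,
      inner_covOp_top_eq_add hS hQ htr ht x]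
    linarith [(isPositive_covOp hS hQ htr t).inner_nonneg_left x]
  · rw [← h1.inner_left_eq_inner_right, ← h1.inner_left_eq_inner_right, h3, h3, ← hSC t ht,
      ContinuousLinearMap.adjoint_inner_right]

/-- ‖Q^{1/2} y‖² is the limit of s⁻¹ ⟨Q_s y, y⟩, and ⟨Q_s y, y⟩ = ‖A y‖² - ‖T_s A y‖² is a defect
form. By `defect_le` it decreases along the contraction T_t, which commutes with T_s and satisfies
T_t A = A S(t)*. -/
theorem norm_sqrtOp_adjoint_le (hS : IsC0Semigroup S) (hQ : Q.IsPositive)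
    (htr : HasFiniteTrace S Q) (hinj : Function.Injective (covOp S Q ⊤))
    (hSC : ∀ t : ℝ, 0 ≤ t → ∀ x, S t (covOp S Q ⊤ x) = covOp S Q ⊤ ((S t).adjoint x))
    {t : ℝ} (ht : 0 ≤ t) (x : H) : ‖sqrtOp Q ((S t).adjoint x)‖ ≤ ‖sqrtOp Q x‖ := by
  obtain ⟨hB, hB2⟩ := sqrtOp_spec hQ
  have hC := isPositive_covOp hS hQ htr ⊤
  obtain ⟨hA, hA2⟩ := sqrtOp_spec hC
  have hAd := denseRange_sqrtOp hC hinj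
  obtain ⟨R, hR, hR1, hRA⟩ := exists_conj_covOp hS hQ htr hinj hSC ht
  refine abs_le_of_sq_le_sq' ?_ (norm_nonneg _) |>.2
  rw [norm_sq_eq_inner_of_comp_self hB hB2, norm_sq_eq_inner_of_comp_self hB hB2]
  refine le_of_tendsto_of_tendsto
    ((tendsto_covOp_div hS hQ htr ((S t).adjoint x)).inner tendsto_const_nhds)
    ((tendsto_covOp_div hS hQ htr x).inner tendsto_const_nhds) ?_
  filter_upwards [self_mem_nhdsWithin] with s (hs : 0 < s)
  rw [real_inner_smul_left, real_inner_smul_left]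
  refine mul_le_mul_of_nonneg_left ?_ (inv_nonneg.2 hs.le)
  obtain ⟨T, hT, hT1, hTA⟩ := exists_conj_covOp hS hQ htr hinj hSC hs.le
  have hform : ∀ y, inner ℝ (covOp S Q s y) y =
      ‖sqrtOp (covOp S Q ⊤) y‖ ^ 2 - ‖T (sqrtOp (covOp S Q ⊤) y)‖ ^ 2 := fun y => by
    rw [hTA, norm_sq_eq_inner_of_comp_self hA hA2, norm_sq_eq_inner_of_comp_self hA hA2,
      inner_covOp_top_eq_add hS hQ htr hs.le y]
    ring
  rw [hform, hform, ← hRA]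
  refine defect_le hT hT1 hR1 (fun z => ?_) _
  refine hAd.induction (P := fun z => T (R z) = R (T z)) ?_
    (isClosed_eq (by fun_prop) (by fun_prop)) z
  rintro _ ⟨y, rfl⟩
  rw [hRA, hTA, hTA, hRA, hS.adjoint_comm hs.le ht]

/-- `S_Q(t)` is a selfadjoint contraction. -/
theorem conjSemigroup_spec (hS : IsC0Semigroup S) (hQ : Q.IsPositive)
    (htr : HasFiniteTrace S Q) (hinj : Function.Injective (covOp S Q ⊤))
    (hSC : ∀ t : ℝ, 0 ≤ t → ∀ x, S t (covOp S Q ⊤ x) = covOp S Q ⊤ ((S t).adjoint x))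
    {t : ℝ} (ht : 0 ≤ t) : IsSelfAdjoint (conjSemigroup S Q t) ∧
      (∀ x, conjSemigroup S Q t (sqrtOp Q x) = sqrtOp Q ((S t).adjoint x)) ∧
      ∀ x, sqrtOp Q (conjSemigroup S Q t x) = S t (sqrtOp Q x) := by
  obtain ⟨hB, hB2⟩ := sqrtOp_spec hQ
  have hSQ := fun t ht x => comp_eq_comp_adjoint hS hQ htr hSC (t := t) ht x
  have hQinj := injective_of_covOp hS hQ htr hinj hSQ
  have hB0 := sqrtOp_eq_zero_imp hQ hQinj
  have h3 : ∀ z, sqrtOp Q (sqrtOp Q z) = Q z := fun z => DFunLike.congr_fun hB2 z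
  obtain ⟨T, hT, -, hTB⟩ := exists_selfAdjoint_contraction (denseRange_sqrtOp hQ hQinj)
    (norm_sqrtOp_adjoint_le hS hQ htr hinj hSC ht) fun x y => by
      rw [← hB.inner_left_eq_inner_right, ← hB.inner_left_eq_inner_right, h3, h3, ← hSQ t ht,
        ContinuousLinearMap.adjoint_inner_right]
  -- The adjoint of T B = B S(t)*, with T and B selfadjoint.
  have hBT : ∀ x, sqrtOp Q (T x) = S t (sqrtOp Q x) := fun x => by
    refine ext_inner_right ℝ fun y => ?_
    have hTs : inner ℝ (T x) (sqrtOp Q y) = inner ℝ x (T (sqrtOp Q y)) :=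
      ContinuousLinearMap.isSelfAdjoint_iff_isSymmetric.1 hT x (sqrtOp Q y)
    rw [hB.inner_left_eq_inner_right, hTs, hTB, ← hB.inner_left_eq_inner_right,
      ContinuousLinearMap.adjoint_inner_right]
  -- B is injective, so the range condition in the definition of S_Q(t) is empty.
  have hspec := described_spec (p := fun R : H →L[ℝ] H => ∀ x : H,
    R x ∈ (LinearMap.ker (sqrtOp Q).toLinearMap)ᗮ ∧ sqrtOp Q (R x) = S t (sqrtOp Q x))
    ⟨T, fun x => ⟨(Submodule.mem_orthogonal _ _).2 fun u hu => by
      rw [hB0 u hu, inner_zero_left], hBT x⟩⟩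
  have heq : conjSemigroup S Q t = T := by
    ext1 x
    rw [← sub_eq_zero]
    refine hB0 _ ?_
    rw [map_sub, hBT, sub_eq_zero]
    exact (hspec x).2
  rw [heq]
  exact ⟨hT, hTB, hBT⟩

theorem norm_sqrtOp_adjoint_anti (hS : IsC0Semigroup S) (hQ : Q.IsPositive)
    (htr : HasFiniteTrace S Q) (hinj : Function.Injective (covOp S Q ⊤))
    (hSC : ∀ t : ℝ, 0 ≤ t → ∀ x, S t (covOp S Q ⊤ x) = covOp S Q ⊤ ((S t).adjoint x))
    {s t : ℝ} (hs : 0 ≤ s) (hst : s ≤ t) (x : H) :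
    ‖sqrtOp Q ((S t).adjoint x)‖ ≤ ‖sqrtOp Q ((S s).adjoint x)‖ := by
  have h := hS.adjoint_add (sub_nonneg.2 hst) hs x
  rw [sub_add_cancel] at h
  rw [h]
  exact norm_sqrtOp_adjoint_le hS hQ htr hinj hSC (sub_nonneg.2 hst) _

/-- ⟨Q_t x, x⟩ is the integral over (0, t] of ‖Q^{1/2} S(s)* x‖², a decreasing function of s, so the
values at the two ends bound it. -/
theorem inner_covOp_bounds (hS : IsC0Semigroup S) (hQ : Q.IsPositive)
    (htr : HasFiniteTrace S Q) (hinj : Function.Injective (covOp S Q ⊤))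
    (hSC : ∀ t : ℝ, 0 ≤ t → ∀ x, S t (covOp S Q ⊤ x) = covOp S Q ⊤ ((S t).adjoint x))
    {t : ℝ} (ht : 0 ≤ t) (x : H) :
    t * ‖sqrtOp Q ((S t).adjoint x)‖ ^ 2 ≤ inner ℝ (covOp S Q t x) x ∧
      inner ℝ (covOp S Q t x) x ≤ t * ‖sqrtOp Q x‖ ^ 2 := by
  have hset : {s : ℝ | 0 < s ∧ (s : EReal) ≤ (t : EReal)} = Ioc 0 t := by
    ext s
    simp
  have hint : IntegrableOn (fun s => ‖sqrtOp Q ((S s).adjoint x)‖ ^ 2) (Ioc 0 t) :=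
    (integrableOn_norm_sq hS hQ htr x).mono_set Ioc_subset_Ioi_self
  have hconst : ∀ c : ℝ, ∫ _ in Ioc 0 t, c = t * c := fun c => by
    rw [setIntegral_const]
    simp [ht]
  rw [inner_covOp_self hS hQ htr, hset]
  constructor
  · rw [← hconst]
    refine setIntegral_mono_on (integrableOn_const (by simp)) hint measurableSet_Ioc fun s hs => ?_
    exact pow_le_pow_left₀ (norm_nonneg _)
      (norm_sqrtOp_adjoint_anti hS hQ htr hinj hSC hs.1.le hs.2 x) 2
  · rw [← hconst]
    refine setIntegral_mono_on hint (integrableOn_const (by simp)) measurableSet_Ioc fun s hs => ?_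
    exact pow_le_pow_left₀ (norm_nonneg _)
      (norm_sqrtOp_adjoint_le hS hQ htr hinj hSC hs.1.le x) 2

/-- Closability of `Q^{1/2} Q_∞^{-1/2}` and the polar decomposition of its closure, which
intertwines the two conjugates of `S(t)`. -/
theorem exists_polar_opV (hS : IsC0Semigroup S) (hQ : Q.IsPositive)
    (htr : HasFiniteTrace S Q) (hinj : Function.Injective (covOp S Q ⊤))
    (hSC : ∀ t : ℝ, 0 ≤ t → ∀ x, S t (covOp S Q ⊤ x) = covOp S Q ⊤ ((S t).adjoint x)) :
    (opV Q (covOp S Q ⊤)).IsClosable ∧ ∃ (U : H ≃ₗᵢ[ℝ] H) (P : H →ₗ.[ℝ] H),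
      IsPolarDecomposition (opV Q (covOp S Q ⊤)).closure
        (U.toContinuousLinearEquiv : H →L[ℝ] H) P ∧
      ∀ t : ℝ, 0 ≤ t → ∃ T : H →L[ℝ] H,
        (∀ x, T (sqrtOp (covOp S Q ⊤) x) = sqrtOp (covOp S Q ⊤) ((S t).adjoint x)) ∧
        ∀ x, U (T x) = conjSemigroup S Q t (U x) := by
  have hC := isPositive_covOp hS hQ htr ⊤
  obtain ⟨hA, hA2⟩ := sqrtOp_spec hC
  obtain ⟨hB, hB2⟩ := sqrtOp_spec hQ
  have hA0 := sqrtOp_eq_zero_imp hC hinj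
  have hAd := denseRange_sqrtOp hC hinj
  have hQinj := injective_of_covOp hS hQ htr hinj
    fun t ht x => comp_eq_comp_adjoint hS hQ htr hSC (t := t) ht x
  have hB0 := sqrtOp_eq_zero_imp hQ hQinj
  have hBd := denseRange_sqrtOp hQ hQinj
  have hex : ∀ t : ℝ, ∃ T : H →L[ℝ] H, 0 ≤ t → IsSelfAdjoint T ∧ (∀ x, ‖T x‖ ≤ ‖x‖) ∧
      ∀ x, T (sqrtOp (covOp S Q ⊤) x) = sqrtOp (covOp S Q ⊤) ((S t).adjoint x) := fun t => by
    by_cases ht : 0 ≤ t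
    · obtain ⟨T, hT⟩ := exists_conj_covOp hS hQ htr hinj hSC ht
      exact ⟨T, fun _ => hT⟩
    · exact ⟨0, fun h => absurd h ht⟩
  choose T hT using hex
  have hform : ∀ t : ℝ, 0 ≤ t → ∀ y, inner ℝ (covOp S Q t y) y =
      ‖sqrtOp (covOp S Q ⊤) y‖ ^ 2 - ‖T t (sqrtOp (covOp S Q ⊤) y)‖ ^ 2 := fun t ht y => by
    rw [(hT t ht).2.2, norm_sq_eq_inner_of_comp_self hA hA2, norm_sq_eq_inner_of_comp_self hA hA2,
      inner_covOp_top_eq_add hS hQ htr ht y]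
    ring
  obtain ⟨a, b, n, hn, ha, hb, hab⟩ :=
    exists_common_factor (sqrtOp (covOp S Q ⊤)) (sqrtOp Q) hA0
  -- This and the next estimate are the two bounds on ⟨Q_t x, x⟩, extended from the graph of V to
  -- its closure by density of the range of n.
  have hlow : ∀ t : ℝ, 0 ≤ t → ∀ z, t * ‖conjSemigroup S Q t (b z)‖ ^ 2 ≤ ‖a z‖ ^ 2 := by
    intro t ht z
    refine hn.induction (P := fun z => t * ‖conjSemigroup S Q t (b z)‖ ^ 2 ≤ ‖a z‖ ^ 2) ?_
      (isClosed_le (by fun_prop) (by fun_prop)) z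
    rintro _ ⟨x, rfl⟩
    rw [hb, ha, (conjSemigroup_spec hS hQ htr hinj hSC ht).2.1]
    have h1 := (inner_covOp_bounds hS hQ htr hinj hSC ht x).1
    rw [hform t ht] at h1
    linarith [sq_nonneg ‖T t (sqrtOp (covOp S Q ⊤) x)‖]
  have hupp : ∀ t : ℝ, 0 ≤ t → ∀ z, ‖a z‖ ^ 2 - ‖T t (a z)‖ ^ 2 ≤ t * ‖b z‖ ^ 2 := by
    intro t ht z
    refine hn.induction (P := fun z => ‖a z‖ ^ 2 - ‖T t (a z)‖ ^ 2 ≤ t * ‖b z‖ ^ 2) ?_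
      (isClosed_le (by fun_prop) (by fun_prop)) z
    rintro _ ⟨x, rfl⟩
    rw [hb, ha, ← hform t ht]
    exact (inner_covOp_bounds hS hQ htr hinj hSC ht x).2
  have hzero : ∀ z, a z = 0 → b z = 0 → z = 0 := fun z h1 h2 => by
    have := hab z
    rw [h1, h2, norm_zero] at this
    refine norm_eq_zero.1 (pow_eq_zero_iff two_ne_zero |>.1 ?_)
    linarith
  -- Closability: a z = 0 gives S_Q(t) b z = 0, hence S(t) B b z = 0, for all t > 0. Letting t → 0
  -- yields B b z = 0.
  have ha0 : ∀ z, a z = 0 → z = 0 := by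
    intro z hz
    refine hzero z hz (hB0 _ ?_)
    have h1 : ∀ t : ℝ, 0 < t → S t (sqrtOp Q (b z)) = 0 := fun t ht => by
      have h2 := hlow t ht.le z
      rw [hz, norm_zero] at h2
      have h3 : ‖conjSemigroup S Q t (b z)‖ ^ 2 ≤ 0 := by
        by_contra h
        have := mul_pos ht (not_le.1 h)
        linarith
      have h4 : conjSemigroup S Q t (b z) = 0 :=
        norm_eq_zero.1 (pow_eq_zero_iff two_ne_zero |>.1 (le_antisymm h3 (sq_nonneg _)))
      rw [← (conjSemigroup_spec hS hQ htr hinj hSC ht.le).2.2, h4, map_zero]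
    have h2 := ((hS.continuousOn (sqrtOp Q (b z))) 0 self_mem_Ici).mono Ioi_subset_Ici_self
    have h3 : Tendsto (fun t => S t (sqrtOp Q (b z))) (𝓝[>] 0) (𝓝 (S 0 (sqrtOp Q (b z)))) := h2
    rw [hS.map_zero] at h3
    refine tendsto_nhds_unique h3 (tendsto_const_nhds.congr' ?_)
    filter_upwards [self_mem_nhdsWithin] with t ht
    exact (h1 t ht).symm
  -- Injectivity of the closure: b z = 0 gives ‖a z‖ ≤ ‖T_t a z‖ for all t, while T_t → 0 strongly.
  -- The latter holds on the range of A because ‖T_t A x‖² = ⟨Q_∞ x, x⟩ - ⟨Q_t x, x⟩, and elsewhere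
  -- by contractivity.
  have hb0 : ∀ z, b z = 0 → z = 0 := by
    intro z hz
    refine hzero z ?_ hz
    have h1 : ∀ t : ℝ, 0 ≤ t → ‖a z‖ ≤ ‖T t (a z)‖ := fun t ht => by
      have h2 := hupp t ht z
      rw [hz, norm_zero] at h2
      exact abs_le_of_sq_le_sq' (by linarith) (norm_nonneg _) |>.2
    refine norm_eq_zero.1 (le_antisymm (le_of_forall_pos_le_add fun ε hε => ?_) (norm_nonneg _))
    obtain ⟨x, hx⟩ := Metric.denseRange_iff.1 hAd (a z) (ε / 2) (by positivity)
    have h3 : Tendsto (fun t => ‖T t (sqrtOp (covOp S Q ⊤) x)‖ ^ 2) atTop (𝓝 0) := by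
      have h4 := (tendsto_inner_covOp hS hQ htr x).const_sub (inner ℝ (covOp S Q ⊤ x) x)
      rw [sub_self] at h4
      refine h4.congr' ?_
      filter_upwards [eventually_ge_atTop 0] with t ht
      rw [hform t ht, norm_sq_eq_inner_of_comp_self hA hA2]
      ring
    obtain ⟨t, ht0, ht⟩ := ((eventually_ge_atTop 0).and
      (h3.eventually (gt_mem_nhds (show (0 : ℝ) < (ε / 2) ^ 2 by positivity)))).exists
    have h5 : ‖T t (sqrtOp (covOp S Q ⊤) x)‖ ≤ ε / 2 :=
      abs_le_of_sq_le_sq' ht.le (by positivity) |>.2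
    have h6 : ‖T t (a z - sqrtOp (covOp S Q ⊤) x)‖ ≤ ε / 2 :=
      ((hT t ht0).2.1 _).trans (by rw [← dist_eq_norm]; exact hx.le)
    calc ‖a z‖ ≤ ‖T t (a z)‖ := h1 t ht0
      _ = ‖T t (a z - sqrtOp (covOp S Q ⊤) x) + T t (sqrtOp (covOp S Q ⊤) x)‖ := by
        rw [← map_add, sub_add_cancel]
      _ ≤ 0 + ε := (norm_add_le _ _).trans (by linarith)
  obtain ⟨hcl, U, P, hUP, hcomm⟩ := exists_polarDecomposition hn ha hb hab hA0 hAd hBd ha0 hb0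
  refine ⟨hcl, U, P, hUP, fun t ht => ⟨T t, (hT t ht).2.2, ?_⟩⟩
  obtain ⟨hs1, hs2, -⟩ := conjSemigroup_spec hS hQ htr hinj hSC ht
  -- Here L = S(t)*, which A turns into T_t and B into S_Q(t).
  exact hcomm (T t) (conjSemigroup S Q t) (S t).adjoint (hT t ht).1 hs1
    (fun x => ((hT t ht).2.2 x).symm) fun x => (hs2 x).symm

end Main

/-! ### Second quantization form of R_t -/

section Final

variable {H : Type*} [NormedAddCommGroup H] [InnerProductSpace ℝ H] [CompleteSpace H]
  [MeasurableSpace H] [BorelSpace H] [SecondCountableTopology H]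

/-- The kernel gives ‖E(y) - E(x)‖² = exp ‖y‖² - 2 exp ⟨y, x⟩ + exp ‖x‖², which tends to 0 as y → x.
-/
theorem continuous_wickLp {C : H →L[ℝ] H} {μ : Measure H} (h : IsCenteredGaussian C μ)
    (hC : C.IsPositive) (hinj : Function.Injective C)
    (hw : ∀ x, MemLp (wickExp C μ x) 2 μ) : Continuous (wickLp hw) := by
  refine continuous_iff_continuousAt.2 fun x => ?_
  have h1 : ∀ y, ‖wickLp hw y - wickLp hw x‖ ^ 2 =
      Real.exp (inner ℝ y y) - 2 * Real.exp (inner ℝ y x) + Real.exp (inner ℝ x x) := fun y => by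
    rw [norm_sub_sq_real, inner_wickLp h hC hinj, ← real_inner_self_eq_norm_sq,
      ← real_inner_self_eq_norm_sq, inner_wickLp h hC hinj, inner_wickLp h hC hinj]
  have h2 : Tendsto (fun y => ‖wickLp hw y - wickLp hw x‖ ^ 2) (𝓝 x) (𝓝 0) := by
    simp_rw [h1]
    have hc : Continuous fun y : H => Real.exp (inner ℝ y y) - 2 * Real.exp (inner ℝ y x) +
      Real.exp (inner ℝ x x) := by fun_prop
    have := hc.tendsto x
    convert this using 2
    ring
  rw [ContinuousAt, tendsto_iff_norm_sub_tendsto_zero]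
  have h3 := (Real.continuous_sqrt.tendsto 0).comp h2
  rw [Real.sqrt_zero] at h3
  exact h3.congr fun y => Real.sqrt_sq (norm_nonneg _)

/-- `R_t` is the second quantization of the conjugate of `S(t)*` by `Q_∞^{1/2}`. -/
theorem ouOperator_wickLp_of_conj {S : ℝ → H →L[ℝ] H} {Q : H →L[ℝ] H} (hS : IsC0Semigroup S)
    (hQ : Q.IsPositive) (htr : HasFiniteTrace S Q) (hinj : Function.Injective (covOp S Q ⊤))
    (hw : ∀ x, MemLp (wickExp (covOp S Q ⊤) (invMeasure S Q) x) 2 (invMeasure S Q))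
    {t : ℝ} (ht : 0 ≤ t) {T : H →L[ℝ] H}
    (hT : ∀ x, T (sqrtOp (covOp S Q ⊤) x) = sqrtOp (covOp S Q ⊤) ((S t).adjoint x)) (x : H) :
    ouOperator S Q t (wickLp hw x) = wickLp hw (T x) := by
  have hC := isPositive_covOp hS hQ htr ⊤
  have hc := continuous_wickLp (isCenteredGaussian_invMeasure hS hQ htr) hC hinj hw
  refine (denseRange_sqrtOp hC hinj).induction
    (P := fun x => ouOperator S Q t (wickLp hw x) = wickLp hw (T x)) ?_
    (isClosed_eq (by fun_prop) (by fun_prop)) x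
  rintro _ ⟨k, rfl⟩
  rw [ouOperator_wickLp hS hQ htr hinj hw ht, hT]

end Final

end OrnsteinUhlenbeck

theorem theorem2p8 {H : Type*} [NormedAddCommGroup H] [InnerProductSpace ℝ H] [CompleteSpace H]
    [SecondCountableTopology H] [MeasurableSpace H] [BorelSpace H]
    (S : ℝ → H →L[ℝ] H) (hS : OrnsteinUhlenbeck.IsC0Semigroup S)
    (Q : H →L[ℝ] H) (hQ : Q.IsPositive)
    (htr : ∫⁻ s in Set.Ioi (0 : ℝ),
      OrnsteinUhlenbeck.opTrace ((S s).comp (Q.comp (S s).adjoint)) < ⊤)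
    (hinj : Function.Injective (OrnsteinUhlenbeck.covOp S Q ⊤))
    (hsymm : OrnsteinUhlenbeck.IsSymmetricOU S Q) :
    (OrnsteinUhlenbeck.opV Q (OrnsteinUhlenbeck.covOp S Q ⊤)).IsClosable ∧
    ∃ (U : H ≃ₗᵢ[ℝ] H) (P : H →ₗ.[ℝ] H)
      (𝒰 : Lp ℝ 2 (OrnsteinUhlenbeck.invMeasure S Q) ≃ₗᵢ[ℝ]
        Lp ℝ 2 (OrnsteinUhlenbeck.invMeasure S Q)),
      OrnsteinUhlenbeck.IsPolarDecomposition
        (OrnsteinUhlenbeck.opV Q (OrnsteinUhlenbeck.covOp S Q ⊤)).closure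
        (U.toContinuousLinearEquiv : H →L[ℝ] H) P ∧
      (∀ f, 𝒰 f = OrnsteinUhlenbeck.secondQuantization (OrnsteinUhlenbeck.covOp S Q ⊤)
        (OrnsteinUhlenbeck.invMeasure S Q) (U.toContinuousLinearEquiv : H →L[ℝ] H) f) ∧
      ∀ t : ℝ, 0 ≤ t → ∀ f,
        OrnsteinUhlenbeck.ouOperator S Q t f =
          𝒰.symm (OrnsteinUhlenbeck.secondQuantization (OrnsteinUhlenbeck.covOp S Q ⊤)
            (OrnsteinUhlenbeck.invMeasure S Q) (OrnsteinUhlenbeck.conjSemigroup S Q t) (𝒰 f)) := by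
  have hμ := OrnsteinUhlenbeck.isCenteredGaussian_invMeasure hS hQ htr
  have hC := OrnsteinUhlenbeck.isPositive_covOp hS hQ htr ⊤
  have hw := OrnsteinUhlenbeck.memLp_wickExp hμ hC hinj
  obtain ⟨hcl, U, P, hUP, hT⟩ := OrnsteinUhlenbeck.exists_polar_opV hS hQ htr hinj
    fun t ht x => OrnsteinUhlenbeck.comp_covOp_of_symmetric hS hQ htr hinj hsymm ht x
  obtain ⟨𝒰, h𝒰⟩ := OrnsteinUhlenbeck.exists_unitary_secondQuantization hμ hC hinj hw U
  refine ⟨hcl, U, P, 𝒰, hUP, fun f => ?_, fun t ht f => ?_⟩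
  · rw [OrnsteinUhlenbeck.secondQuantization_eq hμ hC hinj hw
      (T := (U.toContinuousLinearEquiv : H →L[ℝ] H))
      (G := 𝒰.toLinearIsometry.toContinuousLinearMap) h𝒰]
    rfl
  · obtain ⟨T, hTA, hTU⟩ := hT t ht
    -- For x = U y, 𝒰 R_t 𝒰⁻¹ sends E(U y) to 𝒰 R_t E(y) = 𝒰 E(T_t y) = E(U T_t y) = E(S_Q(t) U y);
    -- totality of the exponentials identifies it with Γ(S_Q(t)).
    have hG : ∀ x, (𝒰.toLinearIsometry.toContinuousLinearMap.comp
        ((OrnsteinUhlenbeck.ouOperator S Q t).comp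
          𝒰.symm.toLinearIsometry.toContinuousLinearMap)) (OrnsteinUhlenbeck.wickLp hw x) =
        OrnsteinUhlenbeck.wickLp hw (OrnsteinUhlenbeck.conjSemigroup S Q t x) := by
      intro x
      obtain ⟨y, rfl⟩ := U.surjective x
      change 𝒰 (OrnsteinUhlenbeck.ouOperator S Q t (𝒰.symm (OrnsteinUhlenbeck.wickLp hw (U y)))) = _
      rw [← h𝒰, LinearIsometryEquiv.symm_apply_apply,
        OrnsteinUhlenbeck.ouOperator_wickLp_of_conj hS hQ htr hinj hw ht hTA, h𝒰, hTU]
    rw [OrnsteinUhlenbeck.secondQuantization_eq hμ hC hinj hw hG]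
    change _ = 𝒰.symm (𝒰 (OrnsteinUhlenbeck.ouOperator S Q t (𝒰.symm (𝒰 f))))
    rw [LinearIsometryEquiv.symm_apply_apply, LinearIsometryEquiv.symm_apply_apply]
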